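/- For an integer $n\ge 1$ let $A_n$ be the number of dimer coverings (perfect matchings, equivalently domino tilings) of the $2n\times 2n$ square lattice graph, and let $B_n>0$ be defined by $A_n = 2^n B_n^2$. Then every $B_n$ is a (positive) integer, and the following congruences hold. For every integer $\lambda\ge 0$, $$B_{2\lambda+1} \equiv -16(\lambda+1)\binom{\lambda+2}{3} - 16\binom{\lambda+2}{4} - 4\binom{\lambda+1}{2} + 1 \pmod{64},$$ and for every integer $\lambda\ge 1$, $$(-1)^{\lambda} B_{2\lambda} \equiv -16\lambda\binom{\lambda+1}{3} - 16\binom{\lambda+2}{4} - 4\binom{\lambda+1}{2} + 1 \pmod{64}.$$ -/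

import Mathlib

open scoped SimpleGraph

/-- The `m × m` square lattice graph: its vertices are the `m ^ 2` squares of an `m × m` chessboard,
two of them adjacent when the squares share a side. -/
def squareLattice (m : ℕ) : SimpleGraph (Fin m × Fin m) :=
  SimpleGraph.pathGraph m □ SimpleGraph.pathGraph m

/-- `A_n`: the number of dimer coverings (perfect matchings, i.e. domino tilings)
of the `2n × 2n` square lattice graph. -/
noncomputable def dimerCount (n : ℕ) : ℕ :=
  Nat.card {M : (squareLattice (2 * n)).Subgraph // M.IsPerfectMatching}

namespace Domino

open Finset

/-- The real number `2 cos (2 π a / N)`, for `a` a residue class modulo `N`. -/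
noncomputable def dcos {N : ℕ} [NeZero N] (a : ZMod N) : ℝ := 2 * (ZMod.stdAddChar a : ℂ).re

lemma isUnit_two_of_odd {N : ℕ} (hN : Odd N) : IsUnit (2 : ZMod N) := by
  have : IsUnit ((2 : ℕ) : ZMod N) := (ZMod.isUnit_iff_coprime 2 N).2 hN.coprime_two_left
  simpa using this

lemma one_add_ne_zero_of_pow_odd_eq_one {N : ℕ} (hN : Odd N) {w : ℂ} (hw : w ^ N = 1) : 1 + w ≠ 0 := by
  intro h
  have hw' : w = -1 := by linear_combination h
  rw [hw', hN.neg_one_pow] at hw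
  norm_num at hw

section dcos

variable {N : ℕ} [NeZero N]

lemma stdAddChar_neg (a : ZMod N) :
    (ZMod.stdAddChar (-a) : ℂ) = (starRingEnd ℂ) (ZMod.stdAddChar a) := by
  rw [ZMod.stdAddChar_apply, ZMod.stdAddChar_apply, AddChar.map_neg_eq_inv, Circle.coe_inv_eq_conj]

lemma coe_dcos (a : ZMod N) :
    (dcos a : ℂ) = ZMod.stdAddChar a + ZMod.stdAddChar (-a) := by
  rw [stdAddChar_neg, Complex.add_conj, dcos]

lemma stdAddChar_mul_neg (a : ZMod N) :
    (ZMod.stdAddChar a : ℂ) * ZMod.stdAddChar (-a) = 1 := by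
  rw [← AddChar.map_add_eq_mul, add_neg_cancel, AddChar.map_zero_eq_one]

lemma stdAddChar_pow_card (a : ZMod N) : (ZMod.stdAddChar a : ℂ) ^ N = 1 := by
  rw [← AddChar.map_nsmul_eq_pow]
  simp

@[simp] lemma dcos_neg (a : ZMod N) : dcos (-a) = dcos a := by
  simp [dcos, stdAddChar_neg]

@[simp] lemma dcos_zero : dcos (0 : ZMod N) = 2 := by
  simp [dcos]

lemma dcos_add_add_dcos_sub (a b : ZMod N) : dcos (a + b) + dcos (a - b) = dcos a * dcos b := by
  have h : ((dcos (a + b) + dcos (a - b) : ℝ) : ℂ) = ((dcos a * dcos b : ℝ) : ℂ) := by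
    push_cast
    simp only [coe_dcos, sub_eq_add_neg, neg_add, neg_neg, AddChar.map_add_eq_mul]
    ring
  exact_mod_cast h

lemma dcos_two_mul (a : ZMod N) : dcos (2 * a) + 2 = dcos a ^ 2 := by
  have := dcos_add_add_dcos_sub a a
  rw [sub_self, dcos_zero, ← two_mul] at this
  rw [this, sq]

lemma dcos_natCast (j : ℕ) : dcos (j : ZMod N) = 2 * Real.cos (2 * Real.pi * j / N) := by
  have h := ZMod.stdAddChar_coe (N := N) (j : ℤ)
  rw [dcos, ← Int.cast_natCast (R := ZMod N) j, h]
  congr 1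
  have : (2 * Real.pi * Complex.I * ((j : ℤ) : ℂ) / N : ℂ)
      = ((2 * Real.pi * j / N : ℝ) : ℂ) * Complex.I := by
    push_cast; ring
  rw [this, Complex.exp_ofReal_mul_I_re]

lemma stdAddChar_sq_pow_card (a : ZMod N) : ((ZMod.stdAddChar a : ℂ) ^ 2) ^ N = 1 := by
  rw [← pow_mul, mul_comm, pow_mul, stdAddChar_pow_card, one_pow]

lemma stdAddChar_mul_dcos (a : ZMod N) :
    (ZMod.stdAddChar a : ℂ) * dcos a = 1 + (ZMod.stdAddChar a : ℂ) ^ 2 := by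
  rw [coe_dcos, mul_add, stdAddChar_mul_neg]
  ring

lemma dcos_ne_zero (hN : Odd N) (a : ZMod N) : dcos a ≠ 0 := by
  intro h
  have h1 := stdAddChar_mul_dcos a
  rw [h] at h1
  exact one_add_ne_zero_of_pow_odd_eq_one hN (stdAddChar_sq_pow_card a) (by simpa using h1.symm)

/-- The substitution `j = a + b`, `k = a - b` modulo an odd number. -/
@[to_additive]
lemma prod_prod_add_sub {M : Type*} [CommMonoid M] (hN : Odd N) (F : ZMod N → ZMod N → M) :
    ∏ j, ∏ k, F j k = ∏ a, ∏ b, F (a + b) (a - b) := by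
  have hb : Function.Bijective (fun p : ZMod N × ZMod N => (p.1 + p.2, p.1 - p.2)) := by
    rw [← Finite.injective_iff_bijective]
    rintro ⟨a, b⟩ ⟨c, d⟩ h
    simp only [Prod.mk.injEq] at h
    obtain ⟨h1, h2⟩ := h
    have h3 : (2 : ZMod N) * a = 2 * c := by linear_combination h1 + h2
    have h4 : (2 : ZMod N) * b = 2 * d := by linear_combination h1 - h2
    rw [(isUnit_two_of_odd hN).mul_right_inj] at h3 h4
    rw [h3, h4]
  rw [← Fintype.prod_prod_type' (f := F), ← Fintype.prod_prod_type' (f := fun a b => F (a + b) (a - b))]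
  exact (hb.prod_comp (fun p : ZMod N × ZMod N => F p.1 p.2)).symm

@[to_additive]
lemma prod_comp_double {M : Type*} [CommMonoid M] (hN : Odd N) (F : ZMod N → M) :
    ∏ a, F (2 * a) = ∏ a, F a := by
  have hb : Function.Bijective (fun a : ZMod N => 2 * a) := by
    rw [← Finite.injective_iff_bijective]
    intro a b h
    exact (isUnit_two_of_odd hN).mul_right_inj.1 h
  exact hb.prod_comp F

end dcos

/-- A product of an even function over the nonzero residues modulo `2 n + 1`. -/
@[to_additive]
lemma prod_fin_two_mul_of_even {M : Type*} [CommMonoid M] (n : ℕ) (F : ZMod (2 * n + 1) → M)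
    (hF : ∀ a, F (-a) = F a) :
    ∏ i : Fin (2 * n), F ((i : ℕ) + 1 : ℕ) = (∏ j : Fin n, F ((j : ℕ) + 1 : ℕ)) ^ 2 := by
  rw [Fin.prod_univ_eq_prod_range (fun x => F ((x + 1 : ℕ))),
    Fin.prod_univ_eq_prod_range (fun x => F ((x + 1 : ℕ))),
    show range (2 * n) = range (n + n) by rw [two_mul], prod_range_add, sq]
  congr 1
  refine prod_nbij' (fun x => n - 1 - x) (fun x => n - 1 - x) ?_ ?_ ?_ ?_ ?_
  iterate 4
    intro x hx
    simp only [mem_range] at hx ⊢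
    omega
  intro x hx
  rw [mem_range] at hx
  rw [← hF]
  congr 1
  rw [neg_eq_iff_add_eq_zero, ← Nat.cast_add,
    show n + x + 1 + (n - 1 - x + 1) = 2 * n + 1 by omega]
  exact ZMod.natCast_self _

/-- A product of an even function over all residues modulo `2 n + 1`. -/
@[to_additive]
lemma prod_zmod_of_even {M : Type*} [CommMonoid M] (n : ℕ) (F : ZMod (2 * n + 1) → M)
    (hF : ∀ a, F (-a) = F a) :
    ∏ a, F a = F 0 * (∏ j : Fin n, F ((j : ℕ) + 1 : ℕ)) ^ 2 := by
  have h1 : ∏ a, F a = ∏ i ∈ range (2 * n + 1), F (i : ℕ) := by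
    refine Finset.prod_nbij' (fun a => a.val) (fun i => (i : ZMod (2 * n + 1))) ?_ ?_ ?_ ?_ ?_
    · intro a _; exact mem_range.2 (ZMod.val_lt a)
    · intro i _; exact mem_univ _
    · intro a _; exact ZMod.natCast_zmod_val a
    · intro i hi; exact ZMod.val_cast_of_lt (mem_range.1 hi)
    · intro a _; rw [ZMod.natCast_zmod_val]
  rw [h1, prod_range_succ', mul_comm, Nat.cast_zero, ← prod_fin_two_mul_of_even n F hF,
    Fin.prod_univ_eq_prod_range (fun x => F ((x + 1 : ℕ)))]

section powerSums

variable {N : ℕ} [NeZero N]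

lemma sum_stdAddChar_mul (b : ZMod N) :
    ∑ a : ZMod N, (ZMod.stdAddChar (a * b) : ℂ) = if b = 0 then (N : ℂ) else 0 := by
  rw [AddChar.sum_mulShift b (ZMod.isPrimitive_stdAddChar N), ZMod.card]
  split_ifs <;> simp

lemma inv_dcos_eq_div (hN : Odd N) (a : ZMod N) :
    ((dcos a : ℂ))⁻¹ = ZMod.stdAddChar a / (1 + (ZMod.stdAddChar a : ℂ) ^ 2) := by
  have h0 : (dcos a : ℂ) ≠ 0 := by exact_mod_cast dcos_ne_zero hN a
  have h1 := one_add_ne_zero_of_pow_odd_eq_one hN (stdAddChar_sq_pow_card a)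
  rw [inv_eq_one_div, div_eq_div_iff h0 h1, one_mul, stdAddChar_mul_dcos]

lemma inv_dcos_eq_sum (hN : Odd N) (a : ZMod N) :
    ((dcos a : ℂ))⁻¹ =
      1 / 2 * ∑ i ∈ range N, (-1) ^ i * (ZMod.stdAddChar (a * ((2 * i + 1 : ℕ) : ZMod N)) : ℂ) := by
  have h1 := one_add_ne_zero_of_pow_odd_eq_one hN (stdAddChar_sq_pow_card a)
  have hpow := stdAddChar_sq_pow_card a
  have hmul (i : ℕ) : (ZMod.stdAddChar (a * (i : ZMod N)) : ℂ) = ZMod.stdAddChar a ^ i := by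
    rw [mul_comm, ← nsmul_eq_mul, AddChar.map_nsmul_eq_pow]
  rw [inv_dcos_eq_div hN]
  simp only [hmul]
  generalize (ZMod.stdAddChar a : ℂ) = z at *
  have h2 := geom_sum_mul (-(z ^ 2)) N
  rw [hN.neg_pow, hpow] at h2
  have h3 : ∑ i ∈ range N, (-1) ^ i * z ^ (2 * i + 1) = z * ∑ i ∈ range N, (-(z ^ 2)) ^ i := by
    rw [mul_sum]
    refine sum_congr rfl fun i _ => ?_
    rw [neg_pow (z ^ 2), ← pow_mul]
    ring
  rw [h3, div_eq_iff h1]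
  linear_combination z / 2 * h2

lemma sum_sub_two_mul_pow (x y : ℂ) (M : ℕ) :
    (1 - y) ^ 2 * ∑ m ∈ range M, (x - 2 * m) * y ^ m =
      x * (1 - y) * (1 - y ^ M) - 2 * (y - M * y ^ M + (M - 1) * y ^ (M + 1)) := by
  induction M with
  | zero => simp
  | succ M ih =>
    rw [sum_range_succ, mul_add, ih]
    push_cast
    ring

lemma inv_dcos_sq_eq_sum (hN : Odd N) (a : ZMod N) :
    ((dcos a : ℂ))⁻¹ ^ 2 =
      1 / 4 * ∑ m ∈ range N,
        (-1) ^ m * ((N : ℂ) - 2 * m) * (ZMod.stdAddChar ((2 * a) * (m : ZMod N)) : ℂ) := by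
  have h1 := one_add_ne_zero_of_pow_odd_eq_one hN (stdAddChar_sq_pow_card a)
  have hpow := stdAddChar_sq_pow_card a
  have hmul (i : ℕ) : (ZMod.stdAddChar ((2 * a) * (i : ZMod N)) : ℂ) =
      (ZMod.stdAddChar a ^ 2) ^ i := by
    rw [mul_comm, ← nsmul_eq_mul, AddChar.map_nsmul_eq_pow, two_mul, AddChar.map_add_eq_mul, sq]
  rw [inv_dcos_eq_div hN, div_pow]
  simp only [hmul]
  generalize (ZMod.stdAddChar a : ℂ) ^ 2 = w at *
  have h2 := sum_sub_two_mul_pow N (-w) N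
  rw [pow_succ (-w), hN.neg_pow, hpow] at h2
  have h3 : ∑ m ∈ range N, (-1) ^ m * ((N : ℂ) - 2 * m) * w ^ m =
      ∑ m ∈ range N, ((N : ℂ) - 2 * m) * (-w) ^ m := by
    refine sum_congr rfl fun i _ => ?_
    rw [neg_pow w]
    ring
  rw [h3, div_eq_iff (pow_ne_zero 2 h1)]
  linear_combination -1 / 4 * h2

omit [NeZero N] in
lemma natCast_sub_natCast_eq_zero_iff {m k : ℕ} (hm : m < N) (hk : k < N) :
    (m : ZMod N) - k = 0 ↔ m = k := by
  rw [sub_eq_zero, ZMod.natCast_eq_natCast_iff', Nat.mod_eq_of_lt hm, Nat.mod_eq_of_lt hk]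

lemma sum_range_sub_two_mul_sq (x : ℂ) (M : ℕ) :
    ∑ m ∈ range M, (x - 2 * m) ^ 2 =
      M * x ^ 2 - 2 * x * M * (M - 1) + 2 / 3 * M * (M - 1) * (2 * M - 1) := by
  induction M with
  | zero => simp
  | succ M ih =>
    rw [sum_range_succ, ih]
    push_cast
    ring

/-- Parseval's identity for functions on `ZMod N` given by their Fourier coefficients. -/
lemma sum_mul_sum_stdAddChar (c : ℕ → ℂ) :
    ∑ a : ZMod N, (∑ m ∈ range N, c m * (ZMod.stdAddChar (a * (m : ZMod N)) : ℂ)) *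
      (∑ m ∈ range N, c m * (ZMod.stdAddChar (-a * (m : ZMod N)) : ℂ)) =
      N * ∑ m ∈ range N, c m ^ 2 := by
  have h1 (a : ZMod N) : (∑ m ∈ range N, c m * (ZMod.stdAddChar (a * (m : ZMod N)) : ℂ)) *
      (∑ m ∈ range N, c m * (ZMod.stdAddChar (-a * (m : ZMod N)) : ℂ)) =
      ∑ m ∈ range N, ∑ k ∈ range N,
        c m * c k * (ZMod.stdAddChar (a * ((m : ZMod N) - (k : ZMod N))) : ℂ) := by
    rw [sum_mul_sum]
    refine sum_congr rfl fun m _ => sum_congr rfl fun k _ => ?_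
    rw [show a * ((m : ZMod N) - (k : ZMod N)) = a * m + -a * k by ring, AddChar.map_add_eq_mul]
    ring
  simp only [h1]
  rw [sum_comm, mul_sum]
  refine sum_congr rfl fun m hm => ?_
  rw [sum_comm]
  simp only [← mul_sum, sum_stdAddChar_mul]
  rw [sum_eq_single m]
  · simp only [sub_self, if_true]
    ring
  · intro k hk hkm
    rw [if_neg, mul_zero]
    rw [natCast_sub_natCast_eq_zero_iff (mem_range.1 hm) (mem_range.1 hk)]
    exact fun h => hkm h.symm
  · exact fun h => absurd hm h

lemma sum_inv_dcos_pow_four (hN : Odd N) :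
    ∑ a : ZMod N, (dcos a)⁻¹ ^ 4 = ((N : ℝ) ^ 4 + 2 * N ^ 2) / 48 := by
  have h := sum_mul_sum_stdAddChar (N := N) (fun m => (-1) ^ m * ((N : ℂ) - 2 * m))
  rw [← sum_comp_double hN] at h
  have h2 (a : ZMod N) : ((dcos a : ℂ))⁻¹ ^ 4 = 1 / 16 *
      ((∑ m ∈ range N, (-1) ^ m * ((N : ℂ) - 2 * m) *
          (ZMod.stdAddChar ((2 * a) * (m : ZMod N)) : ℂ)) *
       (∑ m ∈ range N, (-1) ^ m * ((N : ℂ) - 2 * m) *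
          (ZMod.stdAddChar (-(2 * a) * (m : ZMod N)) : ℂ))) := by
    have e1 := inv_dcos_sq_eq_sum hN a
    have e2 := inv_dcos_sq_eq_sum hN (-a)
    rw [dcos_neg, mul_neg] at e2
    calc ((dcos a : ℂ))⁻¹ ^ 4 = ((dcos a : ℂ))⁻¹ ^ 2 * ((dcos a : ℂ))⁻¹ ^ 2 := by ring
      _ = _ := by
        nth_rewrite 1 [e1]
        rw [e2]
        ring
  have h3 : ((∑ a : ZMod N, (dcos a)⁻¹ ^ 4 : ℝ) : ℂ) = ((((N : ℝ) ^ 4 + 2 * N ^ 2) / 48 : ℝ) : ℂ) := by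
    push_cast
    simp only [h2]
    rw [← mul_sum, h]
    have h4 (m : ℕ) : ((-1) ^ m * ((N : ℂ) - 2 * m)) ^ 2 = ((N : ℂ) - 2 * m) ^ 2 := by
      rw [mul_pow, ← pow_mul, mul_comm m 2, pow_mul, neg_one_sq, one_pow, one_mul]
    simp only [h4]
    rw [sum_range_sub_two_mul_sq]
    ring
  exact_mod_cast h3

lemma sum_inv_dcos_sq (hN : Odd N) :
    ∑ a : ZMod N, (dcos a)⁻¹ ^ 2 = (N : ℝ) ^ 2 / 4 := by
  have h3 : ((∑ a : ZMod N, (dcos a)⁻¹ ^ 2 : ℝ) : ℂ) = (((N : ℝ) ^ 2 / 4 : ℝ) : ℂ) := by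
    push_cast
    simp only [inv_dcos_sq_eq_sum hN]
    rw [← mul_sum, sum_comp_double hN (fun a => ∑ m ∈ range N,
        (-1) ^ m * ((N : ℂ) - 2 * m) * (ZMod.stdAddChar (a * (m : ZMod N)) : ℂ)), sum_comm]
    simp only [← mul_sum, sum_stdAddChar_mul]
    rw [sum_eq_single 0]
    · simp
      ring
    · intro m hm hm0
      rw [if_neg, mul_zero]
      exact fun h => hm0 (Nat.eq_zero_of_dvd_of_lt ((ZMod.natCast_eq_zero_iff _ _).1 h)
        (mem_range.1 hm))
    · exact fun h => absurd (mem_range.2 (NeZero.pos N)) h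
  exact_mod_cast h3

end powerSums

lemma sum_inv_dcos (n : ℕ) :
    ∑ a : ZMod (2 * n + 1), (dcos a)⁻¹ = (-1) ^ n * (2 * n + 1) / 2 := by
  have h3 : ((∑ a : ZMod (2 * n + 1), (dcos a)⁻¹ : ℝ) : ℂ) =
      (((-1) ^ n * (2 * n + 1) / 2 : ℝ) : ℂ) := by
    push_cast
    simp only [inv_dcos_eq_sum (odd_two_mul_add_one n)]
    rw [← mul_sum, sum_comm]
    simp only [← mul_sum, sum_stdAddChar_mul]
    rw [sum_eq_single n]
    · rw [if_pos (ZMod.natCast_self _)]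
      push_cast
      ring
    · intro m hm hmn
      rw [if_neg, mul_zero]
      rw [ZMod.natCast_eq_zero_iff]
      rintro ⟨k, hk⟩
      rw [mem_range] at hm
      have : k < 2 := by
        by_contra hk2
        have : (2 * n + 1) * 2 ≤ (2 * n + 1) * k := Nat.mul_le_mul_left _ (by omega)
        omega
      interval_cases k <;> omega
    · exact fun h => absurd (mem_range.2 (by omega)) h
  exact_mod_cast h3

lemma prod_stdAddChar {N : ℕ} [NeZero N] (hN : Odd N) :
    ∏ a : ZMod N, (ZMod.stdAddChar a : ℂ) = 1 := by
  have h := prod_comp_double hN (fun a => (ZMod.stdAddChar a : ℂ))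
  simp only [two_mul, AddChar.map_add_eq_mul, prod_mul_distrib] at h
  have h0 : ∏ a : ZMod N, (ZMod.stdAddChar a : ℂ) ≠ 0 :=
    prod_ne_zero_iff.2 fun a _ => left_ne_zero_of_mul_eq_one (stdAddChar_mul_neg a)
  exact mul_left_cancel₀ h0 (by rw [h, mul_one])

lemma prod_one_add_stdAddChar {N : ℕ} [NeZero N] (hN : Odd N) :
    ∏ a : ZMod N, (1 + (ZMod.stdAddChar a : ℂ)) = 2 := by
  set g : ZMod N → ℂ := fun a => if a = 0 then 1 else 1 - ZMod.stdAddChar a with hg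
  have hg0 : ∏ a, g a ≠ 0 := by
    refine prod_ne_zero_iff.2 fun a _ => ?_
    simp only [hg]
    split_ifs with ha
    · exact one_ne_zero
    · intro h
      apply ha
      apply ZMod.injective_stdAddChar
      rw [AddChar.map_zero_eq_one]
      linear_combination -h
  have h (a : ZMod N) : 2 * a = 0 ↔ a = 0 := (isUnit_two_of_odd hN).mul_right_eq_zero
  have h1 (a : ZMod N) : g (2 * a) * (if a = 0 then 2 else 1) = g a * (1 + ZMod.stdAddChar a) := by
    simp only [hg, h]
    split_ifs with ha
    · rw [ha, AddChar.map_zero_eq_one]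
      norm_num
    · rw [two_mul, AddChar.map_add_eq_mul]
      ring
  have h2 := Fintype.prod_congr _ _ h1
  rw [prod_mul_distrib, prod_mul_distrib, prod_comp_double hN, Fintype.prod_ite_eq'] at h2
  exact (mul_left_cancel₀ hg0 h2).symm

lemma prod_dcos {N : ℕ} [NeZero N] (hN : Odd N) : ∏ a : ZMod N, dcos a = 2 := by
  have h3 : ((∏ a : ZMod N, dcos a : ℝ) : ℂ) = ((2 : ℝ) : ℂ) := by
    push_cast
    have h1 (a : ZMod N) : (ZMod.stdAddChar a : ℂ) * dcos a = 1 + ZMod.stdAddChar (2 * a) := by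
      rw [stdAddChar_mul_dcos, two_mul, AddChar.map_add_eq_mul, sq]
    have h2 := Fintype.prod_congr _ _ h1
    rwa [prod_mul_distrib, prod_stdAddChar hN, one_mul,
      prod_comp_double hN (fun a => 1 + (ZMod.stdAddChar a : ℂ)), prod_one_add_stdAddChar hN] at h2
  exact_mod_cast h3

@[to_additive]
lemma prod_prod_of_symm {n : ℕ} {M : Type*} [CommMonoid M] (F : Fin n → Fin n → M)
    (hF : ∀ i j, F i j = F j i) :
    ∏ i, ∏ j, F i j = (∏ i, F i i) * (∏ i, ∏ j ∈ Ioi i, F i j) ^ 2 := by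
  have h : ∏ i, ∏ j, F i j = ∏ i, (F i i * ∏ j ∈ {i}ᶜ, F i j) :=
    prod_congr rfl fun i _ => by rw [Fintype.prod_eq_mul_prod_compl i]
  rw [h, prod_mul_distrib, ← prod_prod_Ioi_mul_eq_prod_prod_off_diag]
  congr 1
  rw [sq, ← prod_mul_distrib]
  refine prod_congr rfl fun i _ => ?_
  rw [← prod_mul_distrib]
  refine prod_congr rfl fun j _ => ?_
  rw [hF j i]

/-- The numbers `2 cos (2 π j / (2 n + 1))` with `1 ≤ j ≤ n`. -/
noncomputable def cosRoot (n : ℕ) (j : Fin n) : ℝ := dcos (((j : ℕ) + 1 : ℕ) : ZMod (2 * n + 1))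

lemma cosRoot_eq (n : ℕ) (j : Fin n) :
    cosRoot n j = 2 * Real.cos (2 * Real.pi * ((j : ℕ) + 1) / (2 * n + 1)) := by
  rw [cosRoot, dcos_natCast]
  push_cast
  rfl

lemma cosRoot_angle_mem (n : ℕ) (j : Fin n) :
    2 * Real.pi * ((j : ℕ) + 1) / (2 * n + 1) ∈ Set.Ioo 0 Real.pi := by
  have h : ((j : ℕ) : ℝ) + 1 ≤ n := by exact_mod_cast j.2
  have hp := Real.pi_pos
  constructor
  · positivity
  · rw [div_lt_iff₀ (by positivity)]
    nlinarith

lemma cosRoot_injective (n : ℕ) : Function.Injective (cosRoot n) := by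
  intro i j h
  rw [cosRoot_eq, cosRoot_eq] at h
  have h1 := Real.injOn_cos (Set.Ioo_subset_Icc_self (cosRoot_angle_mem n i))
    (Set.Ioo_subset_Icc_self (cosRoot_angle_mem n j)) (by linarith)
  have hp := Real.pi_pos
  have hn : (2 * (n : ℝ) + 1) ≠ 0 := by positivity
  field_simp at h1
  ext
  exact_mod_cast (by linarith : ((i : ℕ) : ℝ) = (j : ℕ))

lemma two_add_cosRoot_pos (n : ℕ) (j : Fin n) : 0 < 2 + cosRoot n j := by
  rw [cosRoot_eq]
  have h := cosRoot_angle_mem n j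
  have h1 := Real.strictAntiOn_cos (Set.Ioo_subset_Icc_self h)
    (Set.right_mem_Icc.2 Real.pi_pos.le) h.2
  rw [Real.cos_pi] at h1
  linarith

lemma cosRoot_add_cosRoot_sign (n : ℕ) (i j : Fin n) :
    0 < (if n ≤ (i : ℕ) + j + 1 then (-1 : ℝ) else 1) * (cosRoot n i + cosRoot n j) := by
  have hi := Set.Ioo_subset_Icc_self (cosRoot_angle_mem n i)
  have hj := cosRoot_angle_mem n j
  rw [cosRoot_eq, cosRoot_eq]
  have hp := Real.pi_pos
  have hn : (0 : ℝ) < 2 * n + 1 := by positivity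
  have hj' : Real.pi - 2 * Real.pi * ((j : ℕ) + 1) / (2 * n + 1) ∈ Set.Icc 0 Real.pi :=
    ⟨by linarith [hj.2], by linarith [hj.1]⟩
  have hc := Real.cos_pi_sub (2 * Real.pi * ((j : ℕ) + 1) / (2 * n + 1))
  split_ifs with h
  · have h' : (n : ℝ) ≤ (i : ℕ) + (j : ℕ) + 1 := by exact_mod_cast h
    have := Real.strictAntiOn_cos hj' hi (by
      rw [sub_lt_iff_lt_add, ← add_div, lt_div_iff₀ hn]
      nlinarith)
    linarith
  · have h' : ((i : ℕ) : ℝ) + (j : ℕ) + 1 + 1 ≤ n := by exact_mod_cast (not_le.1 h)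
    have := Real.strictAntiOn_cos hi hj' (by
      rw [lt_sub_iff_add_lt, ← add_div, div_lt_iff₀ hn]
      nlinarith)
    linarith

lemma prod_cosRoot_sq (n : ℕ) : (∏ j, cosRoot n j) ^ 2 = 1 := by
  have h := prod_dcos (odd_two_mul_add_one n)
  rw [prod_zmod_of_even n _ dcos_neg, dcos_zero] at h
  exact mul_left_cancel₀ two_ne_zero (h.trans (mul_one 2).symm)

lemma prod_two_add_dcos {N : ℕ} [NeZero N] (hN : Odd N) : ∏ a : ZMod N, (2 + dcos a) = 4 := by
  rw [← prod_comp_double hN]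
  have h (a : ZMod N) : 2 + dcos (2 * a) = dcos a ^ 2 := by rw [← dcos_two_mul, add_comm]
  simp only [h]
  rw [prod_pow, prod_dcos hN]
  norm_num

lemma prod_two_add_cosRoot (n : ℕ) : ∏ j, (2 + cosRoot n j) = 1 := by
  have h := prod_two_add_dcos (odd_two_mul_add_one n)
  rw [prod_zmod_of_even n _ (fun a => by rw [dcos_neg]), dcos_zero] at h
  have h1 : (∏ j, (2 + cosRoot n j)) ^ 2 = 1 := by
    unfold cosRoot
    linarith
  have h2 : 0 < ∏ j, (2 + cosRoot n j) := prod_pos fun j _ => two_add_cosRoot_pos n j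
  nlinarith

/-- The product of the pairwise sums of the numbers `cosRoot n j`. -/
noncomputable def cosRootSumProd (n : ℕ) : ℝ := ∏ i, ∏ j ∈ Ioi i, (cosRoot n i + cosRoot n j)

lemma cosRootSumProd_sq (n : ℕ) : cosRootSumProd n ^ 2 = 1 := by
  have hN := odd_two_mul_add_one n
  set W := ∏ i, ∏ j, (cosRoot n i + cosRoot n j) with hW
  have h1 : ∏ a : ZMod (2 * n + 1), ∏ b : ZMod (2 * n + 1), (dcos a + dcos b) =
      4 * W ^ 4 := by
    rw [prod_zmod_of_even n _ (fun a => by simp only [dcos_neg])]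
    simp only [dcos_zero]
    rw [prod_two_add_dcos hN]
    have h2 (j : Fin n) : ∏ b : ZMod (2 * n + 1), (dcos (((j : ℕ) + 1 : ℕ) : ZMod (2 * n + 1)) + dcos b) =
        (2 + cosRoot n j) * (∏ k, (cosRoot n j + cosRoot n k)) ^ 2 := by
      rw [prod_zmod_of_even n _ (fun a => by rw [dcos_neg]), dcos_zero, add_comm _ (2 : ℝ)]
      rfl
    rw [prod_congr rfl fun j _ => h2 j, prod_mul_distrib, prod_two_add_cosRoot, prod_pow]
    ring
  have h3 : W ^ 4 = (2 ^ n) ^ 4 := by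
    rw [prod_prod_add_sub hN] at h1
    simp only [dcos_add_add_dcos_sub, prod_mul_distrib, prod_const, prod_pow, prod_dcos hN,
      card_univ, ZMod.card] at h1
    have h4 : (2 : ℝ) ^ (2 * n + 1) * 2 ^ (2 * n + 1) = 4 * (2 ^ n) ^ 4 := by ring
    linarith
  have h4 : W = (2 ^ n * ∏ j, cosRoot n j) * cosRootSumProd n ^ 2 := by
    rw [hW, prod_prod_of_symm _ (fun i j => add_comm _ _), cosRootSumProd]
    simp only [← two_mul]
    rw [prod_mul_distrib, prod_const, card_univ, Fintype.card_fin]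
  have h5 : ((cosRootSumProd n) ^ 2) ^ 4 = 1 := by
    have h6 := prod_cosRoot_sq n
    have h7 : (2 ^ n : ℝ) ^ 4 ≠ 0 := by positivity
    rw [h4, mul_pow, mul_pow, show (∏ j, cosRoot n j) ^ 4 = ((∏ j, cosRoot n j) ^ 2) ^ 2 by ring,
      h6, one_pow, mul_one] at h3
    exact mul_left_cancel₀ h7 (by rw [h3, mul_one])
  exact (pow_eq_one_iff_of_nonneg (sq_nonneg _) (by norm_num)).1 h5

@[to_additive]
lemma prod_prod_Ioi_eq_prod_range {M : Type*} [CommMonoid M] (n : ℕ) (f : ℕ → ℕ → M) :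
    ∏ i : Fin n, ∏ j ∈ Ioi i, f i j = ∏ j ∈ range n, ∏ i ∈ range j, f i j := by
  rw [prod_comm' (t' := univ) (s' := fun j => Iio j) (by simp), ← Fin.prod_univ_eq_prod_range]
  refine prod_congr rfl fun j _ => ?_
  rw [← Nat.Iio_eq_range, ← Fin.map_valEmbedding_Iio, prod_map]
  rfl

lemma prod_sign_eq (n j : ℕ) (hj : j < n) :
    ∏ i ∈ range j, (if n ≤ i + j + 1 then (-1 : ℝ) else 1) = (-1) ^ (2 * j + 1 - n) := by
  rw [prod_ite, prod_const, prod_const_one, mul_one]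
  congr 1
  have : (range j).filter (fun i => n ≤ i + j + 1) = Ico (n - 1 - j) j := by
    ext i
    simp only [mem_filter, mem_range, mem_Ico]
    omega
  rw [this, Nat.card_Ico]
  omega

lemma cosRootSumProd_eq_prod (n : ℕ) :
    cosRootSumProd n = ∏ j ∈ range n, (-1) ^ (2 * j + 1 - n) := by
  have h : 0 < (∏ j ∈ range n, (-1 : ℝ) ^ (2 * j + 1 - n)) * cosRootSumProd n := by
    rw [← prod_congr rfl fun j hj => prod_sign_eq n j (mem_range.1 hj),
      ← prod_prod_Ioi_eq_prod_range n (fun i j => if n ≤ i + j + 1 then (-1 : ℝ) else 1),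
      cosRootSumProd, ← prod_mul_distrib]
    refine prod_pos fun i _ => ?_
    rw [← prod_mul_distrib]
    exact prod_pos fun j _ => cosRoot_add_cosRoot_sign n i j
  have h1 := cosRootSumProd_sq n
  have h2 : (∏ j ∈ range n, (-1 : ℝ) ^ (2 * j + 1 - n)) ^ 2 = 1 := by
    rw [← prod_pow]
    refine prod_eq_one fun j _ => ?_
    rw [← pow_mul, mul_comm, pow_mul, neg_one_sq, one_pow]
  rcases sq_eq_sq_iff_eq_or_eq_neg.1 (h1.trans h2.symm) with h3 | h3
  · exact h3
  · rw [h3] at h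
    nlinarith

lemma cosRootSumProd_odd (l : ℕ) : cosRootSumProd (2 * l + 1) = 1 := by
  rw [cosRootSumProd_eq_prod]
  refine prod_eq_one fun j _ => Even.neg_one_pow ?_
  rw [show 2 * j + 1 - (2 * l + 1) = 2 * (j - l) by omega]
  exact even_two_mul _

lemma cosRootSumProd_even (l : ℕ) : cosRootSumProd (2 * l) = (-1) ^ l := by
  rw [cosRootSumProd_eq_prod, show range (2 * l) = range (l + l) by rw [two_mul], prod_range_add,
    prod_eq_one, one_mul, prod_congr rfl (g := fun _ => (-1 : ℝ)), prod_const, card_range]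
  · intro j _
    refine Odd.neg_one_pow ?_
    rw [show 2 * (l + j) + 1 - 2 * l = 2 * j + 1 by omega]
    exact odd_two_mul_add_one j
  · intro j hj
    rw [mem_range] at hj
    rw [show 2 * j + 1 - 2 * l = 0 by omega, pow_zero]

lemma sum_inv_cosRoot_add_cosRoot_pow (n r : ℕ) :
    (∑ a : ZMod (2 * n + 1), (dcos a)⁻¹ ^ r) ^ 2 =
      2 * (∑ a : ZMod (2 * n + 1), (dcos a)⁻¹ ^ (2 * r)) - (1 / 4) ^ r
        + 2 * (1 / 2) ^ r * ((∑ a : ZMod (2 * n + 1), (dcos a)⁻¹ ^ r) - (1 / 2) ^ r)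
        + 8 * ∑ i, ∑ j ∈ Ioi i, (cosRoot n i + cosRoot n j)⁻¹ ^ r := by
  have hN := odd_two_mul_add_one n
  have h1 : ∑ a : ZMod (2 * n + 1), (dcos a)⁻¹ ^ r =
      (1 / 2) ^ r + 2 * ∑ j, (cosRoot n j)⁻¹ ^ r := by
    rw [sum_zmod_of_even n _ (fun a => by rw [dcos_neg]), dcos_zero, nsmul_eq_mul, one_div]
    rfl
  have h2 : ∑ b : ZMod (2 * n + 1), (2 + dcos b)⁻¹ ^ r =
      ∑ a : ZMod (2 * n + 1), (dcos a)⁻¹ ^ (2 * r) := by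
    rw [← sum_comp_double hN]
    refine sum_congr rfl fun a _ => ?_
    rw [add_comm, dcos_two_mul, pow_mul, inv_pow (dcos a) 2]
  have h3 : ∑ a : ZMod (2 * n + 1), (dcos a)⁻¹ ^ (2 * r) =
      (1 / 4) ^ r + 2 * ∑ j, (2 + cosRoot n j)⁻¹ ^ r := by
    rw [← h2, sum_zmod_of_even n _ (fun a => by rw [dcos_neg]), dcos_zero, nsmul_eq_mul,
      show (2 + 2 : ℝ)⁻¹ = 1 / 4 by norm_num]
    rfl
  have h4 : ∑ a : ZMod (2 * n + 1), ∑ b : ZMod (2 * n + 1), (dcos a + dcos b)⁻¹ ^ r =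
      (∑ a : ZMod (2 * n + 1), (dcos a)⁻¹ ^ r) ^ 2 := by
    rw [sum_sum_add_sub hN, sq, sum_mul_sum]
    simp only [dcos_add_add_dcos_sub, mul_inv, mul_pow]
  have h5 : ∑ a : ZMod (2 * n + 1), ∑ b : ZMod (2 * n + 1), (dcos a + dcos b)⁻¹ ^ r =
      (∑ a : ZMod (2 * n + 1), (dcos a)⁻¹ ^ (2 * r)) + 2 * ((∑ j, (2 + cosRoot n j)⁻¹ ^ r)
        + 2 * ∑ i, ∑ j, (cosRoot n i + cosRoot n j)⁻¹ ^ r) := by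
    rw [sum_zmod_of_even n _ (fun a => by simp only [dcos_neg])]
    simp only [dcos_zero]
    rw [h2, nsmul_eq_mul, Nat.cast_ofNat]
    congr 2
    rw [mul_sum, ← sum_add_distrib]
    refine sum_congr rfl fun i _ => ?_
    rw [sum_zmod_of_even n _ (fun a => by rw [dcos_neg]), dcos_zero, nsmul_eq_mul,
      add_comm _ (2 : ℝ)]
    rfl
  have h6 : ∑ i, ∑ j, (cosRoot n i + cosRoot n j)⁻¹ ^ r =
      (1 / 2) ^ r * ∑ j, (cosRoot n j)⁻¹ ^ r
        + 2 * ∑ i, ∑ j ∈ Ioi i, (cosRoot n i + cosRoot n j)⁻¹ ^ r := by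
    rw [sum_sum_of_symm _ (fun i j => by rw [add_comm]), nsmul_eq_mul, Nat.cast_ofNat]
    congr 1
    rw [mul_sum]
    refine sum_congr rfl fun i _ => ?_
    rw [← two_mul, mul_inv, mul_pow, one_div]
  rw [h6] at h5
  rw [← h4, h5, h1]
  linear_combination -h3

lemma sum_inv_cosRoot_add_cosRoot (n : ℕ) :
    ∑ i, ∑ j ∈ Ioi i, (cosRoot n i + cosRoot n j)⁻¹ =
      -(n * (n + 1) : ℝ) / 8 - ((-1) ^ n * (2 * n + 1) - 1) / 16 := by
  have h := sum_inv_cosRoot_add_cosRoot_pow n 1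
  have hs : ((-1 : ℝ) ^ n) ^ 2 = 1 := by rw [← pow_mul, mul_comm, pow_mul, neg_one_sq, one_pow]
  simp only [pow_one, mul_one] at h
  rw [sum_inv_dcos, sum_inv_dcos_sq (odd_two_mul_add_one n)] at h
  push_cast at h
  linear_combination -1 / 8 * h + (2 * n + 1) ^ 2 / 32 * hs

lemma sum_inv_cosRoot_add_cosRoot_sq (n : ℕ) :
    ∑ i, ∑ j ∈ Ioi i, (cosRoot n i + cosRoot n j)⁻¹ ^ 2 =
      ((n - 1) * n * (n + 1) * (n + 2) : ℝ) / 24 := by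
  have h := sum_inv_cosRoot_add_cosRoot_pow n 2
  rw [sum_inv_dcos_pow_four (odd_two_mul_add_one n), sum_inv_dcos_sq (odd_two_mul_add_one n)] at h
  push_cast at h
  linear_combination -1 / 8 * h

/-- The monic integer polynomials with `sin (θ / 2) * P_k (2 + 2 cos θ) = sin ((2 k + 1) θ / 2)`. -/
noncomputable def cosPoly : ℕ → Polynomial ℤ
  | 0 => 1
  | 1 => Polynomial.X - 1
  | k + 2 => (Polynomial.X - 2) * cosPoly (k + 1) - cosPoly k

lemma cosPoly_monic_natDegree (k : ℕ) :
    ((cosPoly k).Monic ∧ (cosPoly k).natDegree = k) ∧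
      (cosPoly (k + 1)).Monic ∧ (cosPoly (k + 1)).natDegree = k + 1 := by
  induction k with
  | zero =>
    have h : (Polynomial.X - 1 : Polynomial ℤ) = Polynomial.X - Polynomial.C 1 := by simp
    refine ⟨⟨Polynomial.monic_one, Polynomial.natDegree_one⟩, ?_, ?_⟩
    · rw [zero_add, cosPoly, h]
      exact Polynomial.monic_X_sub_C 1
    · rw [zero_add, cosPoly, h]
      exact Polynomial.natDegree_X_sub_C 1
  | succ k ih =>
    refine ⟨ih.2, ?_⟩
    have h : (Polynomial.X - 2 : Polynomial ℤ) = Polynomial.X - Polynomial.C 2 := by simp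
    have hm : ((Polynomial.X - 2 : Polynomial ℤ) * cosPoly (k + 1)).Monic := by
      rw [h]
      exact (Polynomial.monic_X_sub_C 2).mul ih.2.1
    have hd : ((Polynomial.X - 2 : Polynomial ℤ) * cosPoly (k + 1)).natDegree = k + 2 := by
      rw [h, (Polynomial.monic_X_sub_C 2).natDegree_mul ih.2.1, ih.2.2, Polynomial.natDegree_X_sub_C]
      ring
    have hlt : (cosPoly k).degree <
        ((Polynomial.X - 2 : Polynomial ℤ) * cosPoly (k + 1)).degree :=
      Polynomial.degree_lt_degree (by rw [hd, ih.1.2]; omega)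
    rw [cosPoly]
    refine ⟨hm.sub_of_left hlt, ?_⟩
    rw [Polynomial.natDegree_eq_of_degree_eq (Polynomial.degree_sub_eq_left_of_degree_lt hlt), hd]

lemma aeval_cosPoly_mul_sin (θ : ℝ) (k : ℕ) :
    Polynomial.aeval (2 + 2 * Real.cos θ) (cosPoly k) * Real.sin (θ / 2) =
        Real.sin ((2 * k + 1) * (θ / 2)) ∧
      Polynomial.aeval (2 + 2 * Real.cos θ) (cosPoly (k + 1)) * Real.sin (θ / 2) =
        Real.sin ((2 * k + 3) * (θ / 2)) := by
  have hstep (x : ℝ) : 2 * Real.cos θ * Real.sin x = Real.sin (x + θ) + Real.sin (x - θ) := by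
    rw [Real.sin_add, Real.sin_sub]
    ring
  induction k with
  | zero =>
    refine ⟨by simp [cosPoly], ?_⟩
    simp only [cosPoly, map_sub, Polynomial.aeval_X, map_one]
    have h := hstep (θ / 2)
    rw [show θ / 2 - θ = -(θ / 2) by ring, Real.sin_neg] at h
    rw [show (2 * ((0 : ℕ) : ℝ) + 3) * (θ / 2) = θ / 2 + θ by push_cast; ring]
    linear_combination h
  | succ k ih =>
    refine ⟨by rw [ih.2]; push_cast; ring_nf, ?_⟩
    have h := hstep ((2 * k + 3) * (θ / 2))
    rw [show (2 * (k : ℝ) + 3) * (θ / 2) - θ = (2 * k + 1) * (θ / 2) by ring] at h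
    rw [show (2 * ((k + 1 : ℕ) : ℝ) + 3) * (θ / 2) = (2 * k + 3) * (θ / 2) + θ by push_cast; ring]
    simp only [cosPoly, map_sub, map_mul, Polynomial.aeval_X, map_ofNat]
    linear_combination h + 2 * Real.cos θ * ih.2 - ih.1

lemma aeval_cosPoly (n : ℕ) (j : Fin n) : Polynomial.aeval (2 + cosRoot n j) (cosPoly n) = 0 := by
  have h := (aeval_cosPoly_mul_sin (2 * Real.pi * ((j : ℕ) + 1) / (2 * n + 1)) n).1
  have hn : (2 * (n : ℝ) + 1) ≠ 0 := by positivity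
  have hm := cosRoot_angle_mem n j
  rw [← cosRoot_eq, show (2 * (n : ℝ) + 1) * (2 * Real.pi * ((j : ℕ) + 1) / (2 * n + 1) / 2) =
    ((j + 1 : ℕ) : ℝ) * Real.pi by push_cast; field_simp, Real.sin_nat_mul_pi] at h
  refine (mul_eq_zero.1 h).resolve_right (Real.sin_pos_of_pos_of_lt_pi ?_ ?_).ne'
  · linarith [hm.1]
  · linarith [hm.1, hm.2]

lemma isIntegral_cosRoot (n : ℕ) (j : Fin n) : IsIntegral ℤ (cosRoot n j) := by
  have h : IsIntegral ℤ (2 + cosRoot n j) :=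
    ⟨cosPoly n, (cosPoly_monic_natDegree n).1.1, aeval_cosPoly n j⟩
  have h2 : IsIntegral ℤ (2 : ℝ) := by exact_mod_cast isIntegral_algebraMap (R := ℤ) (x := (2 : ℤ))
  simpa using h.sub h2

/-- The product of the pairwise sums of the roots of a monic integer polynomial is an integer. -/
lemma exists_int_eq_prod_add {n : ℕ} (x : Fin n → ℝ) (hx : Function.Injective x)
    (P : Polynomial ℤ) (hP : P.Monic) (hd : P.natDegree = n)
    (hroot : ∀ j, Polynomial.aeval (x j) P = 0) :
    ∃ b : ℤ, ∏ i, ∏ j ∈ Ioi i, (x i + x j) = b := by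
  set C : Matrix (Fin n) (Fin n) ℤ :=
    Matrix.of fun k j => ((Polynomial.X ^ (2 * (j : ℕ))) %ₘ P).coeff k with hC
  refine ⟨C.det, ?_⟩
  have h1 : Matrix.vandermonde (fun i => x i ^ 2) =
      Matrix.vandermonde x * C.map (Int.castRingHom ℝ) := by
    ext i j
    rw [Matrix.mul_apply, Matrix.vandermonde_apply, ← pow_mul]
    have h2 : Polynomial.aeval (x i) (Polynomial.X ^ (2 * (j : ℕ)) : Polynomial ℤ) =
        Polynomial.aeval (x i) ((Polynomial.X ^ (2 * (j : ℕ))) %ₘ P) :=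
      (Polynomial.aeval_modByMonic_eq_self_of_root (hroot i)).symm
    rw [map_pow, Polynomial.aeval_X] at h2
    have hn : 0 < n := i.pos
    have hP1 : P ≠ 1 := by
      rintro rfl
      rw [Polynomial.natDegree_one] at hd
      omega
    rw [h2, Polynomial.aeval_eq_sum_range' (n := n)
      ((Polynomial.natDegree_modByMonic_lt _ hP hP1).trans_eq hd),
      ← Fin.sum_univ_eq_sum_range (fun k => ((Polynomial.X ^ (2 * (j : ℕ))) %ₘ P).coeff k • x i ^ k)]
    refine sum_congr rfl fun k _ => ?_
    simp [hC, Matrix.vandermonde_apply, mul_comm]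
  have h3 := congrArg Matrix.det h1
  rw [Matrix.det_mul, Matrix.det_vandermonde, Matrix.det_vandermonde] at h3
  have h4 : ∏ i, ∏ j ∈ Ioi i, (x j ^ 2 - x i ^ 2) =
      (∏ i, ∏ j ∈ Ioi i, (x j - x i)) * ∏ i, ∏ j ∈ Ioi i, (x i + x j) := by
    simp only [← prod_mul_distrib]
    exact prod_congr rfl fun i _ => prod_congr rfl fun j _ => by ring
  have h5 : ∏ i, ∏ j ∈ Ioi i, (x j - x i) ≠ 0 := by
    refine prod_ne_zero_iff.2 fun i _ => prod_ne_zero_iff.2 fun j hj => sub_ne_zero.2 fun h => ?_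
    exact (mem_Ioi.1 hj).ne' (hx h)
  rw [h4] at h3
  rw [mul_left_cancel₀ h5 h3]
  exact (Int.cast_det C).symm

/-- The square root of the odd part of the number of domino tilings. -/
noncomputable def cosRootProd (n : ℕ) : ℝ :=
  ∏ i, ∏ j ∈ Ioi i, ((2 + cosRoot n i) + (2 + cosRoot n j))

lemma cosRootProd_pos (n : ℕ) : 0 < cosRootProd n :=
  prod_pos fun i _ => prod_pos fun j _ =>
    add_pos (two_add_cosRoot_pos n i) (two_add_cosRoot_pos n j)

lemma exists_int_eq_cosRootProd (n : ℕ) : ∃ b : ℤ, cosRootProd n = b :=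
  exists_int_eq_prod_add (fun j => 2 + cosRoot n j)
    (fun _ _ h => cosRoot_injective n (add_left_cancel h)) (cosPoly n)
    (cosPoly_monic_natDegree n).1.1 (cosPoly_monic_natDegree n).1.2 (aeval_cosPoly n)

lemma prod_one_add_four_mul {ι R : Type*} [CommRing R] (S : Subring R) (s : Finset ι) (f : ι → R)
    (hf : ∀ i ∈ s, f i ∈ S) :
    ∃ e ∈ S, ∃ r ∈ S, ∏ i ∈ s, (1 + 4 * f i) = 1 + 4 * ∑ i ∈ s, f i + 16 * e + 64 * r ∧
      2 * e = (∑ i ∈ s, f i) ^ 2 - ∑ i ∈ s, f i ^ 2 := by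
  classical
  induction s using Finset.induction_on with
  | empty => exact ⟨0, S.zero_mem, 0, S.zero_mem, by simp⟩
  | insert a s ha ih =>
    obtain ⟨e, he, r, hr, h1, h2⟩ := ih fun i hi => hf i (mem_insert_of_mem hi)
    have hs : ∑ i ∈ s, f i ∈ S := S.sum_mem fun i hi => hf i (mem_insert_of_mem hi)
    have hfa := hf a (mem_insert_self a s)
    have h4 : (4 : R) ∈ S := by exact_mod_cast natCast_mem S 4
    refine ⟨e + f a * ∑ i ∈ s, f i, S.add_mem he (S.mul_mem hfa hs), r + f a * e + 4 * (f a * r),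
      S.add_mem (S.add_mem hr (S.mul_mem hfa he)) (S.mul_mem h4 (S.mul_mem hfa hr)), ?_, ?_⟩
    · rw [prod_insert ha, sum_insert ha, h1]
      ring
    · rw [sum_insert ha, sum_insert ha]
      linear_combination h2

lemma inv_mem_of_prod_sq_eq_one {ι K : Type*} [Field K] (S : Subring K) (s : Finset ι) (f : ι → K)
    (hf : ∀ i ∈ s, f i ∈ S) (h : (∏ i ∈ s, f i) ^ 2 = 1) {i : ι} (hi : i ∈ s) : (f i)⁻¹ ∈ S := by
  classical
  rw [← mul_prod_erase s f hi] at h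
  rw [inv_eq_of_mul_eq_one_right (b := (f i * ∏ j ∈ s.erase i, f j) * ∏ j ∈ s.erase i, f j)
    (by rw [← h]; ring)]
  have h1 : ∏ j ∈ s.erase i, f j ∈ S := S.prod_mem fun j hj => hf j (mem_of_mem_erase hj)
  exact S.mul_mem (S.mul_mem (hf i hi) h1) h1

lemma cosRootProd_expansion (n : ℕ) : ∃ r : ℝ, IsIntegral ℤ r ∧
    cosRootProd n = cosRootSumProd n *
      (1 + 4 * (∑ i, ∑ j ∈ Ioi i, (cosRoot n i + cosRoot n j)⁻¹)
        + 8 * ((∑ i, ∑ j ∈ Ioi i, (cosRoot n i + cosRoot n j)⁻¹) ^ 2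
          - ∑ i, ∑ j ∈ Ioi i, (cosRoot n i + cosRoot n j)⁻¹ ^ 2) + 64 * r) := by
  set s : Finset (Σ _ : Fin n, Fin n) := univ.sigma fun i => Ioi i
  set f : (Σ _ : Fin n, Fin n) → ℝ := fun p => cosRoot n p.1 + cosRoot n p.2
  set S : Subring ℝ := (integralClosure ℤ ℝ).toSubring
  have hfS : ∀ p ∈ s, f p ∈ S := fun p _ => (isIntegral_cosRoot n p.1).add (isIntegral_cosRoot n p.2)
  have hprod : ∏ p ∈ s, f p = cosRootSumProd n := prod_sigma _ _ _
  have hsq : (∏ p ∈ s, f p) ^ 2 = 1 := by rw [hprod, cosRootSumProd_sq]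
  have hne : ∀ p ∈ s, f p ≠ 0 := prod_ne_zero_iff.1 fun h => by
    rw [h] at hsq
    norm_num at hsq
  obtain ⟨e, -, r, hr, h1, h2⟩ := prod_one_add_four_mul S s (fun p => (f p)⁻¹)
    fun p hp => inv_mem_of_prod_sq_eq_one S s f hfS hsq hp
  refine ⟨r, hr, ?_⟩
  have h3 : cosRootProd n = ∏ p ∈ s, (f p * (1 + 4 * (f p)⁻¹)) := by
    rw [cosRootProd, ← prod_sigma univ (fun i => Ioi i)
      (fun p => (2 + cosRoot n p.1) + (2 + cosRoot n p.2))]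
    refine prod_congr rfl fun p hp => ?_
    have := hne p hp
    field_simp
    simp only [f]
    ring
  rw [← sum_sigma univ (fun i => Ioi i) (fun p => (f p)⁻¹),
    ← sum_sigma univ (fun i => Ioi i) (fun p => (f p)⁻¹ ^ 2), h3, prod_mul_distrib, hprod, h1]
  linear_combination 8 * cosRootSumProd n * h2

lemma int_modEq_of_real_eq {b c : ℤ} {m : ℕ} (hm : m ≠ 0) {r : ℝ} (hr : IsIntegral ℤ r)
    (h : (b : ℝ) = c + m * r) : b ≡ c [ZMOD m] := by
  have hm' : (m : ℝ) ≠ 0 := by exact_mod_cast hm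
  have h1 : r = algebraMap ℚ ℝ ((b - c) / m) := by
    rw [eq_ratCast]
    push_cast
    field_simp
    linarith
  rw [h1, isIntegral_algebraMap_iff (algebraMap ℚ ℝ).injective] at hr
  obtain ⟨k, hk⟩ := IsIntegrallyClosed.isIntegral_iff.1 hr
  have hk' : ((k : ℤ) : ℚ) = (b - c) / m := by simpa using hk
  rw [eq_div_iff (by exact_mod_cast hm)] at hk'
  have h2 : k * m = b - c := by exact_mod_cast hk'
  exact (Int.modEq_iff_dvd.2 ⟨k, by linarith⟩).symm

lemma choose_two_cast (m : ℕ) : ((m + 1).choose 2 : ℝ) = (m + 1) * m / 2 := by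
  rw [Nat.cast_choose_two]
  push_cast
  ring

lemma choose_three_cast (m : ℕ) : ((m + 2).choose 3 : ℝ) = (m + 2) * (m + 1) * m / 6 := by
  induction m with
  | zero => simp
  | succ m ih =>
    rw [show m + 1 + 2 = (m + 2) + 1 by ring, Nat.choose_succ_succ' (m + 2) 2, Nat.cast_add, ih,
      choose_two_cast (m + 1)]
    push_cast
    ring

lemma choose_four_cast (m : ℕ) :
    ((m + 2).choose 4 : ℝ) = (m + 2) * (m + 1) * m * (m - 1) / 24 := by
  induction m with
  | zero => simp [Nat.choose_eq_zero_of_lt]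
  | succ m ih =>
    rw [show m + 1 + 2 = (m + 2) + 1 by ring, Nat.choose_succ_succ' (m + 2) 3, Nat.cast_add, ih,
      choose_three_cast]
    push_cast
    ring

lemma cosRootProd_odd_modEq {l : ℕ} {b : ℤ} (hb : cosRootProd (2 * l + 1) = b) :
    b ≡ -16 * ((l : ℤ) + 1) * (Nat.choose (l + 2) 3 : ℤ) - 16 * (Nat.choose (l + 2) 4 : ℤ)
      - 4 * (Nat.choose (l + 1) 2 : ℤ) + 1 [ZMOD 64] := by
  obtain ⟨r, hr, h⟩ := cosRootProd_expansion (2 * l + 1)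
  refine int_modEq_of_real_eq (m := 64) (by norm_num) hr ?_
  rw [← hb, h, cosRootSumProd_odd, sum_inv_cosRoot_add_cosRoot, sum_inv_cosRoot_add_cosRoot_sq,
    (odd_two_mul_add_one l).neg_one_pow]
  push_cast
  rw [choose_two_cast, choose_three_cast, choose_four_cast]
  ring

lemma cosRootProd_even_modEq {l : ℕ} {b : ℤ} (hl : 1 ≤ l) (hb : cosRootProd (2 * l) = b) :
    (-1) ^ l * b ≡ -16 * (l : ℤ) * (Nat.choose (l + 1) 3 : ℤ) - 16 * (Nat.choose (l + 2) 4 : ℤ)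
      - 4 * (Nat.choose (l + 1) 2 : ℤ) + 1 [ZMOD 64] := by
  obtain ⟨r, hr, h⟩ := cosRootProd_expansion (2 * l)
  refine int_modEq_of_real_eq (m := 64) (by norm_num) hr ?_
  have hs : ((-1 : ℝ) ^ l) * (-1) ^ l = 1 := by rw [← mul_pow]; norm_num
  push_cast
  rw [← hb, h, cosRootSumProd_even, ← mul_assoc, hs, one_mul, sum_inv_cosRoot_add_cosRoot,
    sum_inv_cosRoot_add_cosRoot_sq, (even_two_mul l).neg_one_pow]
  obtain ⟨m, rfl⟩ := Nat.exists_eq_add_of_le' hl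
  push_cast
  rw [choose_two_cast, choose_three_cast, choose_four_cast]
  push_cast
  ring

open scoped Kronecker

/-- The skew-symmetric signed adjacency matrix of the path graph. -/
def pathSkew (R : Type*) [Ring R] (m : ℕ) : Matrix (Fin m) (Fin m) R :=
  Matrix.of fun i j =>
    (if (j : ℕ) = i + 1 then 1 else 0) - (if (i : ℕ) = j + 1 then 1 else 0)

/-- The diagonal matrix of alternating signs. -/
def altSign (R : Type*) [Ring R] (m : ℕ) : Matrix (Fin m) (Fin m) R :=
  Matrix.diagonal fun j => (-1) ^ (j : ℕ)

/-- The Kasteleyn matrix of the square lattice graph. -/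
def kasteleyn (R : Type*) [CommRing R] (m : ℕ) : Matrix (Fin m × Fin m) (Fin m × Fin m) R :=
  1 ⊗ₖ pathSkew R m + pathSkew R m ⊗ₖ altSign R m

lemma pathSkew_mul_altSign (R : Type*) [CommRing R] (m : ℕ) :
    pathSkew R m * altSign R m = -(altSign R m * pathSkew R m) := by
  ext i j
  rw [altSign, Matrix.mul_diagonal, Matrix.neg_apply, Matrix.diagonal_mul]
  simp only [pathSkew, Matrix.of_apply]
  by_cases h1 : (j : ℕ) = i + 1
  · have h2 : ¬ (i : ℕ) = j + 1 := by omega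
    rw [if_pos h1, if_neg h2, h1, pow_succ]
    ring
  · by_cases h2 : (i : ℕ) = j + 1
    · rw [if_neg h1, if_pos h2, h2, pow_succ]
      ring
    · rw [if_neg h1, if_neg h2]
      ring

lemma altSign_mul_self (R : Type*) [CommRing R] (m : ℕ) : altSign R m * altSign R m = 1 := by
  rw [altSign, Matrix.diagonal_mul_diagonal, ← Matrix.diagonal_one]
  congr 1
  funext j
  rw [← mul_pow]
  simp

lemma kasteleyn_mul_self (R : Type*) [CommRing R] (m : ℕ) :
    kasteleyn R m * kasteleyn R m =
      1 ⊗ₖ (pathSkew R m * pathSkew R m) + (pathSkew R m * pathSkew R m) ⊗ₖ 1 := by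
  rw [kasteleyn, Matrix.add_mul, Matrix.mul_add, Matrix.mul_add]
  simp only [← Matrix.mul_kronecker_mul, Matrix.one_mul, Matrix.mul_one, altSign_mul_self]
  rw [pathSkew_mul_altSign]
  have h : pathSkew R m ⊗ₖ (-(altSign R m * pathSkew R m)) =
      -(pathSkew R m ⊗ₖ (altSign R m * pathSkew R m)) := by
    ext i j
    simp
  rw [h]
  abel

lemma pathSkew_sum {R : Type*} [CommRing R] {m : ℕ} (g : ℕ → R) (h0 : g 0 = 0) (hm : g (m + 1) = 0)
    (i : Fin m) : ∑ k : Fin m, pathSkew R m i k * g (k + 1) = g (i + 2) - g i := by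
  simp only [pathSkew, Matrix.of_apply, sub_mul, sum_sub_distrib, ite_mul, one_mul, zero_mul]
  rw [Fin.sum_univ_eq_sum_range (fun k => if k = (i : ℕ) + 1 then g (k + 1) else 0),
    Fin.sum_univ_eq_sum_range (fun k => if (i : ℕ) = k + 1 then g (k + 1) else 0)]
  congr 1
  · rw [sum_ite_eq' (range m) ((i : ℕ) + 1) (fun k => g (k + 1))]
    split_ifs with h
    · rfl
    · rw [mem_range] at h
      rw [show (i : ℕ) + 2 = m + 1 by omega, hm]
  · obtain ⟨i, hi⟩ := i
    cases i with
    | zero => simp [h0]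
    | succ i =>
      simp only [Nat.add_right_cancel_iff]
      rw [sum_ite_eq (range m) i (fun k => g (k + 1)), if_pos (mem_range.2 (by omega))]

/-- The matrix whose columns are the eigenvectors of `pathSkew ℂ m`. -/
noncomputable def sineMatrix (m : ℕ) : Matrix (Fin m) (Fin m) ℂ :=
  Matrix.of fun i j => Complex.I ^ ((i : ℕ) + 1) *
    Complex.sin ((((i : ℕ) + 1 : ℕ) : ℂ) * ((Real.pi * ((j : ℕ) + 1) / (m + 1) : ℝ) : ℂ))

/-- The eigenvalues of `pathSkew ℂ m`. -/
noncomputable def pathEigenvalue (m : ℕ) (j : Fin m) : ℂ :=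
  Complex.I * ((2 * Real.cos (Real.pi * ((j : ℕ) + 1) / (m + 1)) : ℝ) : ℂ)

lemma pathSkew_mul_sineMatrix (m : ℕ) :
    pathSkew ℂ m * sineMatrix m = sineMatrix m * Matrix.diagonal (pathEigenvalue m) := by
  ext i j
  rw [Matrix.mul_apply, Matrix.mul_diagonal]
  have hm : ((m + 1 : ℕ) : ℂ) * ((Real.pi * ((j : ℕ) + 1) / (m + 1) : ℝ) : ℂ) =
      ((j : ℕ) + 1 : ℕ) * (Real.pi : ℂ) := by
    have : ((m : ℂ) + 1) ≠ 0 := by exact_mod_cast Nat.succ_ne_zero m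
    push_cast
    field_simp
  simp only [sineMatrix, pathEigenvalue, Matrix.of_apply]
  generalize hθ : (Real.pi * ((j : ℕ) + 1) / (m + 1) : ℝ) = θ at *
  rw [pathSkew_sum (fun k => Complex.I ^ k * Complex.sin ((k : ℂ) * (θ : ℂ)))
    (by simp) (by rw [hm, Complex.sin_nat_mul_pi, mul_zero]) i]
  have h1 : (((i : ℕ) + 2 : ℕ) : ℂ) * (θ : ℂ) = (((i : ℕ) + 1 : ℕ) : ℂ) * θ + θ := by push_cast; ring
  have h2 : ((i : ℕ) : ℂ) * (θ : ℂ) = (((i : ℕ) + 1 : ℕ) : ℂ) * θ - θ := by push_cast; ring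
  rw [h1, h2, Complex.sin_add, Complex.sin_sub, pow_succ, pow_succ]
  push_cast
  linear_combination (Complex.I ^ (i : ℕ) * (Complex.sin (((i : ℕ) + 1) * θ) * Complex.cos θ
    * (-1) + Complex.cos (((i : ℕ) + 1) * θ) * Complex.sin θ)) * Complex.I_mul_I

lemma pathAngle_mem (m : ℕ) (j : Fin m) :
    Real.pi * ((j : ℕ) + 1) / (m + 1) ∈ Set.Ioo 0 Real.pi := by
  have h : ((j : ℕ) : ℝ) + 1 ≤ m := by exact_mod_cast j.2
  have hp := Real.pi_pos
  constructor
  · positivity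
  · rw [div_lt_iff₀ (by positivity)]
    nlinarith

lemma pathEigenvalue_injective (m : ℕ) : Function.Injective (pathEigenvalue m) := by
  intro i j h
  have h0 := mul_left_cancel₀ Complex.I_ne_zero h
  rw [Complex.ofReal_inj] at h0
  have h1 := Real.injOn_cos (Set.Ioo_subset_Icc_self (pathAngle_mem m i))
    (Set.Ioo_subset_Icc_self (pathAngle_mem m j)) (by linarith)
  have hp := Real.pi_pos
  have hn : ((m : ℝ) + 1) ≠ 0 := by positivity
  field_simp at h1
  ext
  exact_mod_cast (by linarith : ((i : ℕ) : ℝ) = (j : ℕ))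

lemma det_sineMatrix_ne_zero (m : ℕ) : (sineMatrix m).det ≠ 0 := by
  have hli : LinearIndependent ℂ (sineMatrix m).col := by
    refine Module.End.eigenvectors_linearIndependent' (Matrix.toLin' (pathSkew ℂ m))
      (pathEigenvalue m) (pathEigenvalue_injective m) _ fun j => ?_
    rw [Module.End.hasEigenvector_iff, Module.End.mem_eigenspace_iff]
    constructor
    · rw [Matrix.toLin'_apply]
      ext i
      have h := congrFun (congrFun (pathSkew_mul_sineMatrix m) i) j
      rw [Matrix.mul_diagonal, mul_comm] at h
      exact h
    · intro h
      have h0 := congrFun h ⟨0, j.pos⟩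
      have hs := Real.sin_pos_of_mem_Ioo (pathAngle_mem m j)
      simp only [sineMatrix, Matrix.col_apply, Matrix.of_apply, Pi.zero_apply, zero_add, pow_one,
        Nat.cast_one, one_mul, mul_eq_zero, Complex.I_ne_zero, false_or] at h0
      exact hs.ne' (by exact_mod_cast h0)
  exact (Matrix.isUnit_iff_isUnit_det _).1 (Matrix.linearIndependent_cols_iff_isUnit.1 hli) |>.ne_zero

lemma det_kasteleyn_sq (m : ℕ) :
    (kasteleyn ℂ m * kasteleyn ℂ m).det =
      ∏ i, ∏ j, (pathEigenvalue m i ^ 2 + pathEigenvalue m j ^ 2) := by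
  set H := pathSkew ℂ m
  set S := sineMatrix m with hS
  set Λ := Matrix.diagonal (pathEigenvalue m) with hΛ
  have h1 : H * S = S * Λ := pathSkew_mul_sineMatrix m
  have h2 : (H * H) * S = S * (Λ * Λ) := by
    rw [Matrix.mul_assoc, h1, ← Matrix.mul_assoc, h1, Matrix.mul_assoc]
  have h3 : (kasteleyn ℂ m * kasteleyn ℂ m) * (S ⊗ₖ S) =
      (S ⊗ₖ S) * (1 ⊗ₖ (Λ * Λ) + (Λ * Λ) ⊗ₖ 1) := by
    rw [kasteleyn_mul_self, Matrix.add_mul, Matrix.mul_add]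
    simp only [← Matrix.mul_kronecker_mul, Matrix.one_mul, Matrix.mul_one]
    rw [h2]
  have h4 : (1 ⊗ₖ (Λ * Λ) + (Λ * Λ) ⊗ₖ 1 : Matrix (Fin m × Fin m) (Fin m × Fin m) ℂ) =
      Matrix.diagonal fun p => pathEigenvalue m p.1 ^ 2 + pathEigenvalue m p.2 ^ 2 := by
    rw [hΛ, Matrix.diagonal_mul_diagonal, ← Matrix.diagonal_one, Matrix.diagonal_kronecker_diagonal,
      Matrix.diagonal_kronecker_diagonal, Matrix.diagonal_add]
    congr 1
    funext p
    ring
  have h5 := congrArg Matrix.det h3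
  have h6 : (S ⊗ₖ S).det ≠ 0 := by
    rw [Matrix.det_kronecker]
    have := det_sineMatrix_ne_zero m
    positivity
  rw [Matrix.det_mul _ (S ⊗ₖ S), Matrix.det_mul (S ⊗ₖ S), h4, Matrix.det_diagonal, mul_comm] at h5
  rw [mul_left_cancel₀ h6 h5, Fintype.prod_prod_type]

lemma pathEigenvalue_sq (n : ℕ) (i : Fin (2 * n)) :
    pathEigenvalue (2 * n) i ^ 2 =
      -((2 + dcos (((i : ℕ) + 1 : ℕ) : ZMod (2 * n + 1)) : ℝ) : ℂ) := by
  rw [pathEigenvalue, mul_pow, Complex.I_sq, dcos_natCast, neg_one_mul, ← Complex.ofReal_pow]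
  congr 2
  have h := Real.cos_two_mul (Real.pi * ((i : ℕ) + 1) / (2 * n + 1))
  rw [show 2 * Real.pi * (((i : ℕ) + 1 : ℕ) : ℝ) / ((2 * n + 1 : ℕ) : ℝ) =
    2 * (Real.pi * ((i : ℕ) + 1) / (2 * n + 1)) by push_cast; ring, h]
  push_cast
  ring

lemma det_kasteleyn_sq_eq (n : ℕ) :
    (kasteleyn ℂ (2 * n) * kasteleyn ℂ (2 * n)).det =
      (((2 ^ n * cosRootProd n ^ 2) ^ 4 : ℝ) : ℂ) := by
  have h1 : 2 ^ n * cosRootProd n ^ 2 = ∏ i, ∏ j, ((2 + cosRoot n i) + (2 + cosRoot n j)) := by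
    rw [prod_prod_of_symm _ (fun i j => add_comm _ _), cosRootProd]
    simp only [← two_mul (2 + cosRoot n _)]
    rw [prod_mul_distrib, prod_const, card_univ, Fintype.card_fin, prod_two_add_cosRoot, mul_one]
  rw [det_kasteleyn_sq, h1]
  simp only [pathEigenvalue_sq]
  have h2 (i j : Fin (2 * n)) :
      -((2 + dcos (((i : ℕ) + 1 : ℕ) : ZMod (2 * n + 1)) : ℝ) : ℂ)
        + -((2 + dcos (((j : ℕ) + 1 : ℕ) : ZMod (2 * n + 1)) : ℝ) : ℂ) =
      (-1) * (((2 + dcos (((i : ℕ) + 1 : ℕ) : ZMod (2 * n + 1)))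
        + (2 + dcos (((j : ℕ) + 1 : ℕ) : ZMod (2 * n + 1))) : ℝ) : ℂ) := by
    push_cast
    ring
  simp only [h2, prod_mul_distrib, prod_const, card_univ, Fintype.card_fin]
  rw [(even_two_mul n).neg_one_pow, one_pow, one_mul]
  simp only [← Complex.ofReal_prod]
  congr 1
  rw [prod_fin_two_mul_of_even n (fun a => ∏ j : Fin (2 * n), ((2 + dcos a)
    + (2 + dcos (((j : ℕ) + 1 : ℕ) : ZMod (2 * n + 1))))) (fun a => by simp only [dcos_neg])]
  have h3 (i : Fin n) : ∏ j : Fin (2 * n), ((2 + dcos (((i : ℕ) + 1 : ℕ) : ZMod (2 * n + 1)))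
      + (2 + dcos (((j : ℕ) + 1 : ℕ) : ZMod (2 * n + 1)))) =
      (∏ j, ((2 + cosRoot n i) + (2 + cosRoot n j))) ^ 2 :=
    prod_fin_two_mul_of_even n
      (fun b => ((2 + dcos (((i : ℕ) + 1 : ℕ) : ZMod (2 * n + 1))) + (2 + dcos b)))
      (fun b => by rw [dcos_neg])
  rw [prod_congr rfl fun i _ => h3 i, prod_pow, ← pow_mul]

lemma squareLattice_adj {m : ℕ} (u v : Fin m × Fin m) :
    (squareLattice m).Adj u v ↔
      (((u.1 : ℕ) + 1 = v.1 ∨ (v.1 : ℕ) + 1 = u.1) ∧ (u.2 : ℕ) = v.2) ∨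
      (((u.2 : ℕ) + 1 = v.2 ∨ (v.2 : ℕ) + 1 = u.2) ∧ (u.1 : ℕ) = v.1) := by
  simp only [squareLattice, SimpleGraph.boxProd_adj, SimpleGraph.pathGraph_adj, Fin.ext_iff]

/-- A dimer covering of the square lattice, as the involution exchanging matched vertices. -/
structure IsDimer {m : ℕ} (μ : Fin m × Fin m → Fin m × Fin m) : Prop where
  adj : ∀ v, (squareLattice m).Adj v (μ v)
  invol : ∀ v, μ (μ v) = v

/-- The sign comparing two vertices in the lexicographic order. -/
def lexSign {m : ℕ} (u v : Fin m × Fin m) : ℤ :=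
  if (u.1 : ℕ) < v.1 ∨ (u.1 : ℕ) = v.1 ∧ (u.2 : ℕ) < v.2 then 1 else -1

lemma ne_iff_val {m : ℕ} (u v : Fin m × Fin m) :
    u ≠ v ↔ ¬ ((u.1 : ℕ) = v.1 ∧ (u.2 : ℕ) = v.2) := by
  rw [Ne, Prod.ext_iff, Fin.ext_iff, Fin.ext_iff]

lemma lexSign_swap {m : ℕ} {u v : Fin m × Fin m} (h : u ≠ v) : lexSign v u = -lexSign u v := by
  rw [ne_iff_val] at h
  unfold lexSign
  split_ifs <;> first | rfl | omega

lemma lexSign_mul_self {m : ℕ} (u v : Fin m × Fin m) : lexSign u v * lexSign u v = 1 := by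
  unfold lexSign
  split_ifs <;> rfl

/-- The vertex `v` is the upper end of a vertical dimer. -/
def IsTop {m : ℕ} (μ : Fin m × Fin m → Fin m × Fin m) (v : Fin m × Fin m) : Prop :=
  ((μ v).1 : ℕ) = v.1 + 1

instance {m : ℕ} (μ : Fin m × Fin m → Fin m × Fin m) : DecidablePred (IsTop μ) :=
  fun v => inferInstanceAs (Decidable (((μ v).1 : ℕ) = v.1 + 1))

/-- The vertex `v` lies strictly between `u` and the vertex below `u`, lexicographically. -/
def Between {m : ℕ} (u v : Fin m × Fin m) : Prop :=
  (v.1 : ℕ) = u.1 ∧ (u.2 : ℕ) < v.2 ∨ (v.1 : ℕ) = u.1 + 1 ∧ (v.2 : ℕ) < u.2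

instance {m : ℕ} (u v : Fin m × Fin m) : Decidable (Between u v) :=
  inferInstanceAs (Decidable (_ ∨ _))

/-- The crossing sign of the vertical dimers with upper ends `u` and `v`. -/
def crossSign {m : ℕ} (μ : Fin m × Fin m → Fin m × Fin m) (u v : Fin m × Fin m) : ℤ :=
  if IsTop μ u ∧ IsTop μ v ∧ Between u v then -1 else 1

/-- The product of the crossing signs over the ends of two dimers. -/
def dimerCrossSign {m : ℕ} (μ : Fin m × Fin m → Fin m × Fin m) (u v : Fin m × Fin m) : ℤ :=
  (crossSign μ u v * crossSign μ u (μ v)) * (crossSign μ (μ u) v * crossSign μ (μ u) (μ v))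

namespace IsDimer

variable {m : ℕ} {μ : Fin m × Fin m → Fin m × Fin m}

lemma isTop_or (hμ : IsDimer μ) (v : Fin m × Fin m) :
    (IsTop μ v ∧ ¬ IsTop μ (μ v) ∧ ((μ v).2 : ℕ) = v.2) ∨
    (IsTop μ (μ v) ∧ ¬ IsTop μ v ∧ ((μ v).2 : ℕ) = v.2 ∧ (v.1 : ℕ) = (μ v).1 + 1) ∨
    (¬ IsTop μ v ∧ ¬ IsTop μ (μ v) ∧ ((μ v).1 : ℕ) = v.1 ∧
      (((μ v).2 : ℕ) = v.2 + 1 ∨ (v.2 : ℕ) = (μ v).2 + 1)) := by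
  have h := (squareLattice_adj _ _).1 (hμ.adj v)
  unfold IsTop
  rw [hμ.invol]
  omega

lemma crossing_of_isTop {u v : Fin m × Fin m}
    (hu : IsTop μ u ∧ ¬ IsTop μ (μ u) ∧ ((μ u).2 : ℕ) = u.2)
    (hv : IsTop μ v ∧ ¬ IsTop μ (μ v) ∧ ((μ v).2 : ℕ) = v.2) (h1 : u ≠ v) :
    (lexSign u v * lexSign u (μ v)) * (lexSign (μ u) v * lexSign (μ u) (μ v)) =
      dimerCrossSign μ u v * dimerCrossSign μ v u := by
  simp only [dimerCrossSign, crossSign, hu.1, hu.2.1, hv.1, hv.2.1, true_and, false_and, and_false,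
    if_false, mul_one]
  have hu1 := hu.1
  have hv1 := hv.1
  have hu2 := hu.2.2
  have hv2 := hv.2.2
  have h2 : u ≠ μ v := fun h => hv.2.1 (h ▸ hu.1)
  have h3 : v ≠ μ u := fun h => hu.2.1 (h ▸ hv.1)
  rw [ne_iff_val] at h1 h2 h3
  unfold IsTop at hu1 hv1
  simp only [lexSign, hu1, hv1, hu2, hv2]
  by_cases b1 : Between u v <;> by_cases b2 : Between v u <;>
    simp only [b1, b2, if_true, if_false] <;> unfold Between at b1 b2 <;>
    split_ifs <;> first | rfl | omega

lemma crossing_of_row (hμ : IsDimer μ) {u v : Fin m × Fin m}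
    (hu : ¬ IsTop μ u ∧ ¬ IsTop μ (μ u) ∧ ((μ u).1 : ℕ) = u.1 ∧ ((μ u).2 : ℕ) = u.2 + 1)
    (h1 : u ≠ v) (h2 : u ≠ μ v) :
    (lexSign u v * lexSign u (μ v)) * (lexSign (μ u) v * lexSign (μ u) (μ v)) =
      dimerCrossSign μ u v * dimerCrossSign μ v u := by
  have h3 : μ u ≠ v := fun h => h2 (by rw [← h, hμ.invol])
  have h4 : μ u ≠ μ v := fun h => h1 (by rw [← hμ.invol u, h, hμ.invol])
  simp only [dimerCrossSign, crossSign, hu.1, hu.2.1, false_and, and_false, if_false, mul_one]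
  have hu1 := hu.2.2.1
  have hu2 := hu.2.2.2
  rw [ne_iff_val] at h1 h2 h3 h4
  have e (w : Fin m × Fin m) (h : ¬ ((u.1 : ℕ) = w.1 ∧ (u.2 : ℕ) = w.2))
      (h' : ¬ (((μ u).1 : ℕ) = w.1 ∧ ((μ u).2 : ℕ) = w.2)) : lexSign (μ u) w = lexSign u w := by
    unfold lexSign
    split_ifs <;> first | rfl | omega
  rw [e v h1 h3, e (μ v) h2 h4]
  linear_combination (lexSign u (μ v) * lexSign u (μ v)) * lexSign_mul_self u v
    + lexSign_mul_self u (μ v)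

/-- Two dimers, seen as arcs over the lexicographically ordered vertices, cross only
if both are vertical. -/
lemma crossing (hμ : IsDimer μ) {u v : Fin m × Fin m} (h1 : u ≠ v) (h2 : u ≠ μ v) :
    (lexSign u v * lexSign u (μ v)) * (lexSign (μ u) v * lexSign (μ u) (μ v)) =
      dimerCrossSign μ u v * dimerCrossSign μ v u := by
  have h3 : μ u ≠ v := fun h => h2 (by rw [← h, hμ.invol])
  have h4 : μ u ≠ μ v := fun h => h1 (by rw [← hμ.invol u, h, hμ.invol])
  have sc (x y : Fin m × Fin m) : dimerCrossSign μ (μ x) y = dimerCrossSign μ x y := by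
    simp only [dimerCrossSign, hμ.invol]
    ring
  have sc' (x y : Fin m × Fin m) : dimerCrossSign μ x (μ y) = dimerCrossSign μ x y := by
    simp only [dimerCrossSign, hμ.invol]
    ring
  have hself (x : Fin m × Fin m) : μ (μ x) = x := hμ.invol x
  have swap {x y : Fin m × Fin m} (g1 : x ≠ y) (g2 : x ≠ μ y) (g3 : μ x ≠ y) (g4 : μ x ≠ μ y) :
      (lexSign y x * lexSign y (μ x)) * (lexSign (μ y) x * lexSign (μ y) (μ x)) =
      (lexSign x y * lexSign x (μ y)) * (lexSign (μ x) y * lexSign (μ x) (μ y)) := by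
    rw [lexSign_swap g1, lexSign_swap g2, lexSign_swap g3, lexSign_swap g4]
    ring
  have row {x y : Fin m × Fin m} (g1 : x ≠ y) (g2 : x ≠ μ y) (g3 : μ x ≠ y) (g4 : μ x ≠ μ y)
      (hx : ¬ IsTop μ x ∧ ¬ IsTop μ (μ x) ∧ ((μ x).1 : ℕ) = x.1 ∧
        (((μ x).2 : ℕ) = x.2 + 1 ∨ (x.2 : ℕ) = (μ x).2 + 1)) :
      (lexSign x y * lexSign x (μ y)) * (lexSign (μ x) y * lexSign (μ x) (μ y)) =
      dimerCrossSign μ x y * dimerCrossSign μ y x := by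
    obtain ⟨a1, a2, a3, a4 | a4⟩ := hx
    · exact hμ.crossing_of_row ⟨a1, a2, a3, a4⟩ g1 g2
    · have := hμ.crossing_of_row (u := μ x) (v := y)
        ⟨a2, by rwa [hself], by rw [hself, a3], by rw [hself, a4]⟩ g3 g4
      rw [hself, sc, sc'] at this
      rw [← this]
      ring
  rcases hμ.isTop_or u with hu | hu | hu
  · rcases hμ.isTop_or v with hv | hv | hv
    · exact crossing_of_isTop hu hv h1
    · have := crossing_of_isTop (μ := μ) (u := u) (v := μ v) hu
        ⟨hv.1, by rw [hself]; exact hv.2.1, by rw [hself, hv.2.2.1]⟩ h2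
      rw [hself, sc, sc'] at this
      rw [← this]
      ring
    · rw [← swap h1 h2 h3 h4, row h1.symm h3.symm h2.symm h4.symm hv, mul_comm]
  · rcases hμ.isTop_or v with hv | hv | hv
    · have := crossing_of_isTop (μ := μ) (u := μ u) (v := v)
        ⟨hu.1, by rw [hself]; exact hu.2.1, by rw [hself, hu.2.2.1]⟩ hv h3
      rw [hself, sc, sc'] at this
      rw [← this]
      ring
    · have := crossing_of_isTop (μ := μ) (u := μ u) (v := μ v)
        ⟨hu.1, by rw [hself]; exact hu.2.1, by rw [hself, hu.2.2.1]⟩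
        ⟨hv.1, by rw [hself]; exact hv.2.1, by rw [hself, hv.2.2.1]⟩ h4
      rw [hself, hself, sc, sc, sc', sc'] at this
      rw [← this]
      ring
    · rw [← swap h1 h2 h3 h4, row h1.symm h3.symm h2.symm h4.symm hv, mul_comm]
  · exact row h1 h2 h3 h4 hu

lemma dimerCrossSign_self (hμ : IsDimer μ) (u : Fin m × Fin m) : dimerCrossSign μ u u = 1 := by
  have hb (x : Fin m × Fin m) : ¬ Between x x := by unfold Between; omega
  rcases hμ.isTop_or u with hu | hu | hu <;>
    simp [dimerCrossSign, crossSign, hu, hb]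

lemma bijective (hμ : IsDimer μ) : Function.Bijective μ :=
  Function.Involutive.bijective hμ.invol

/-- The number of vertical dimers crossing a given one, modulo two. -/
lemma prod_crossSign (hμ : IsDimer μ) {u : Fin m × Fin m} (hu : IsTop μ u) :
    ∏ v, crossSign μ u v = (-1) ^ (u.2 : ℕ) *
      ∏ v, (if IsTop μ v ∧ v.1 = u.1 ∧ v ≠ u then (-1 : ℤ) else 1) := by
  have hu' : ((μ u).1 : ℕ) = u.1 + 1 := hu
  have hu2 : ((μ u).2 : ℕ) = u.2 := by
    rcases hμ.isTop_or u with h | h | h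
    · exact h.2.2
    · exact absurd hu h.2.1
    · exact absurd hu h.1
  -- the horizontal dimers to the left of `u` in the next row
  have hh : ∏ v, (if (v.1 : ℕ) = u.1 + 1 ∧ (v.2 : ℕ) < u.2 ∧ (μ v).1 = v.1 then (-1 : ℤ) else 1) = 1 := by
    refine prod_involution (fun v _ => μ v) ?_ ?_ (fun v _ => mem_univ _) (fun v _ => hμ.invol v)
    · intro v _
      have hv := (squareLattice_adj _ _).1 (hμ.adj v)
      have key : ((μ v).1 : ℕ) = v.1 → (v.1 : ℕ) = u.1 + 1 →
          (v.2 : ℕ) ≠ u.2 ∧ ((μ v).2 : ℕ) ≠ u.2 := by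
        intro h h'
        constructor <;> intro h''
        · have hvu : v = μ u := by
            by_contra hne
            rw [← Ne, ne_iff_val] at hne
            omega
          rw [hvu, hμ.invol] at h
          omega
        · have hvu : μ v = μ u := by
            by_contra hne
            rw [← Ne, ne_iff_val] at hne
            omega
          rw [hμ.bijective.1 hvu] at h'
          omega
      rw [hμ.invol]
      simp only [Fin.ext_iff]
      split_ifs <;> first | rfl | omega
    · intro v _ _ h
      exact (squareLattice m).ne_of_adj (hμ.adj v) h.symm
  have hk : ∏ v : Fin m × Fin m,
      (if (v.1 : ℕ) = u.1 + 1 ∧ (v.2 : ℕ) < u.2 then (-1 : ℤ) else 1) = (-1) ^ (u.2 : ℕ) := by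
    rw [Fintype.prod_prod_type, Fintype.prod_eq_single (μ u).1]
    · simp only [hu', true_and]
      rw [Fin.prod_univ_eq_prod_range (fun x => if x < (u.2 : ℕ) then (-1 : ℤ) else 1) m, prod_ite,
        prod_const, prod_const_one, mul_one]
      congr 1
      rw [show (range m).filter (fun x => x < (u.2 : ℕ)) = range u.2 by
        ext x; simp only [mem_filter, mem_range]; omega, card_range]
    · intro x hx
      rw [Ne, Fin.ext_iff, hu'] at hx
      simp [hx]
  have hl : ∏ v, (if IsTop μ v ∧ v.1 = u.1 ∧ (v.2 : ℕ) < u.2 then (-1 : ℤ) else 1) =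
      ∏ v, (if IsTop μ (μ v) ∧ (μ v).1 = u.1 ∧ ((μ v).2 : ℕ) < u.2 then (-1 : ℤ) else 1) :=
    (hμ.bijective.prod_comp
      fun v => if IsTop μ v ∧ v.1 = u.1 ∧ (v.2 : ℕ) < u.2 then (-1 : ℤ) else 1).symm
  have hs : ∏ v, (if IsTop μ v ∧ v.1 = u.1 ∧ v ≠ u then (-1 : ℤ) else 1) =
      (∏ v, (if IsTop μ v ∧ v.1 = u.1 ∧ (v.2 : ℕ) < u.2 then (-1 : ℤ) else 1)) *
      ∏ v, (if IsTop μ v ∧ v.1 = u.1 ∧ (u.2 : ℕ) < v.2 then (-1 : ℤ) else 1) := by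
    rw [← prod_mul_distrib]
    refine prod_congr rfl fun v _ => ?_
    by_cases hv : IsTop μ v
    · simp only [hv, true_and, ne_iff_val, Fin.ext_iff]
      split_ifs <;> first | rfl | omega
    · simp only [hv, false_and, if_false, mul_one]
  rw [hs, hl, ← hk]
  refine ((congrArg (· * _) hh).trans (one_mul _)).symm.trans ?_
  simp only [← prod_mul_distrib]
  refine prod_congr rfl fun v _ => ?_
  have hvadj := (squareLattice_adj _ _).1 (hμ.adj v)
  have ht : IsTop μ v ↔ ((μ v).1 : ℕ) = v.1 + 1 := Iff.rfl
  have ht' : IsTop μ (μ v) ↔ (v.1 : ℕ) = (μ v).1 + 1 := by rw [IsTop, hμ.invol]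
  have hb : Between u v ↔
    (v.1 : ℕ) = u.1 ∧ (u.2 : ℕ) < v.2 ∨ (v.1 : ℕ) = u.1 + 1 ∧ (v.2 : ℕ) < u.2 := Iff.rfl
  simp only [crossSign, hu, true_and, hb, ht, ht', Fin.ext_iff]
  split_ifs <;> first | rfl | omega

lemma prod_prod_crossSign (hμ : IsDimer μ) :
    ∏ u, ∏ v, crossSign μ u v = ∏ u : Fin m × Fin m, (if IsTop μ u then (-1) ^ (u.2 : ℕ) else 1) := by
  have h1 : ∏ u, ∏ v, (if IsTop μ u ∧ IsTop μ v ∧ v.1 = u.1 ∧ v ≠ u then (-1 : ℤ) else 1) = 1 := by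
    rw [← Fintype.prod_prod_type']
    refine prod_involution (fun p _ => p.swap) ?_ ?_ (fun p _ => mem_univ _)
      (fun p _ => Prod.swap_swap p)
    · rintro ⟨u, v⟩ _
      have : (IsTop μ v ∧ IsTop μ u ∧ u.1 = v.1 ∧ u ≠ v) ↔
          (IsTop μ u ∧ IsTop μ v ∧ v.1 = u.1 ∧ v ≠ u) := by
        rw [eq_comm (a := u.1), ne_comm (a := u)]
        tauto
      simp only [Prod.fst_swap, Prod.snd_swap, this]
      split_ifs <;> rfl
    · rintro ⟨u, v⟩ _ h h'
      apply h
      rw [if_neg]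
      rintro ⟨_, _, _, hne⟩
      exact hne (congrArg Prod.fst h')
  refine Eq.trans ?_ ((congrArg (_ * ·) h1).trans (mul_one _))
  simp only [← prod_mul_distrib]
  refine prod_congr rfl fun u _ => ?_
  by_cases hu : IsTop μ u
  · rw [hμ.prod_crossSign hu, if_pos hu]
    simp only [hu, true_and]
  · simp [crossSign, hu]

end IsDimer

lemma kasteleyn_apply {R : Type*} [CommRing R] {m : ℕ} (u v : Fin m × Fin m) :
    kasteleyn R m u v = (if (u.1 : ℕ) = v.1 then pathSkew R m u.2 v.2 else 0)
      + pathSkew R m u.1 v.1 * (if (u.2 : ℕ) = v.2 then (-1) ^ (u.2 : ℕ) else 0) := by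
  simp only [kasteleyn, altSign, Matrix.add_apply, Matrix.kroneckerMap_apply, Matrix.one_apply,
    Matrix.diagonal_apply, Fin.ext_iff, ite_mul, one_mul, zero_mul]

lemma kasteleyn_eq_zero {m : ℕ} {u v : Fin m × Fin m} (h : ¬ (squareLattice m).Adj u v) :
    kasteleyn ℤ m u v = 0 := by
  rw [squareLattice_adj] at h
  rw [kasteleyn_apply]
  simp only [pathSkew, Matrix.of_apply]
  split_ifs <;> omega

lemma kasteleyn_swap {m : ℕ} (u v : Fin m × Fin m) :
    kasteleyn ℤ m v u = -kasteleyn ℤ m u v := by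
  rw [kasteleyn_apply, kasteleyn_apply]
  simp only [pathSkew, Matrix.of_apply]
  by_cases h : (u.2 : ℕ) = v.2
  · rw [h]
    split_ifs <;> omega
  · split_ifs <;> omega

lemma kasteleyn_of_adj {m : ℕ} {u v : Fin m × Fin m} (h : (squareLattice m).Adj u v) :
    kasteleyn ℤ m u v = lexSign u v * (if (u.1 : ℕ) = v.1 then 1 else (-1) ^ (u.2 : ℕ)) := by
  rw [squareLattice_adj] at h
  rw [kasteleyn_apply]
  simp only [pathSkew, Matrix.of_apply, lexSign]
  split_ifs <;> omega

lemma kasteleyn_map (m : ℕ) : kasteleyn ℂ m = (kasteleyn ℤ m).map (Int.castRingHom ℂ) := by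
  ext u v
  rw [Matrix.map_apply, kasteleyn_apply, kasteleyn_apply]
  simp only [pathSkew, Matrix.of_apply]
  split_ifs <;> simp

/-- The chessboard colouring of the square lattice. -/
def IsBlack {m : ℕ} (v : Fin m × Fin m) : Prop := Even ((v.1 : ℕ) + v.2)

instance {m : ℕ} : DecidablePred (IsBlack (m := m)) :=
  fun v => inferInstanceAs (Decidable (Even ((v.1 : ℕ) + v.2)))

lemma isBlack_iff_of_adj {m : ℕ} {u v : Fin m × Fin m} (h : (squareLattice m).Adj u v) :
    IsBlack v ↔ ¬ IsBlack u := by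
  rw [squareLattice_adj] at h
  simp only [IsBlack, Nat.even_iff]
  omega

lemma exists_coloring_equiv (n : ℕ) :
    ∃ (k : ℕ) (φ : Fin k ⊕ Fin k ≃ Fin (2 * n) × Fin (2 * n)),
      (∀ i, IsBlack (φ (Sum.inl i))) ∧ ∀ i, ¬ IsBlack (φ (Sum.inr i)) := by
  have hrev (v : Fin (2 * n) × Fin (2 * n)) : IsBlack (v.1, v.2.rev) ↔ ¬ IsBlack v := by
    have := v.2.2
    simp only [IsBlack, Nat.even_iff, Fin.val_rev]
    omega
  let e : {v : Fin (2 * n) × Fin (2 * n) // IsBlack v} ≃ {v : Fin (2 * n) × Fin (2 * n) // ¬ IsBlack v} :=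
    { toFun := fun v => ⟨(v.1.1, v.1.2.rev), fun h => (hrev _).1 h v.2⟩
      invFun := fun v => ⟨(v.1.1, v.1.2.rev), (hrev _).2 v.2⟩
      left_inv := fun v => by simp
      right_inv := fun v => by simp }
  let ε := (Fintype.equivFin {v : Fin (2 * n) × Fin (2 * n) // IsBlack v}).symm
  exact ⟨_, (Equiv.sumCongr ε (ε.trans e)).trans (Equiv.sumCompl IsBlack), fun i => (ε i).2,
    fun i => (e (ε i)).2⟩

section

variable {m k : ℕ} (φ : Fin k ⊕ Fin k ≃ Fin m × Fin m)

/-- The involution which matches the black vertices with the white ones by a permutation. -/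
def permInvolution (τ : Equiv.Perm (Fin k)) (v : Fin m × Fin m) : Fin m × Fin m :=
  φ (Sum.elim (fun i => Sum.inr (τ i)) (fun j => Sum.inl (τ.symm j)) (φ.symm v))

lemma permInvolution_inl (τ : Equiv.Perm (Fin k)) (i : Fin k) :
    permInvolution φ τ (φ (Sum.inl i)) = φ (Sum.inr (τ i)) := by
  simp [permInvolution]

lemma permInvolution_inr (τ : Equiv.Perm (Fin k)) (j : Fin k) :
    permInvolution φ τ (φ (Sum.inr j)) = φ (Sum.inl (τ.symm j)) := by
  simp [permInvolution]

/-- The permutation matches adjacent vertices. -/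
def IsGood (τ : Equiv.Perm (Fin k)) : Prop :=
  ∀ i, (squareLattice m).Adj (φ (Sum.inl i)) (φ (Sum.inr (τ i)))

variable {φ}

lemma IsGood.isDimer {τ : Equiv.Perm (Fin k)} (h : IsGood φ τ) : IsDimer (permInvolution φ τ) where
  adj v := by
    obtain ⟨x, rfl⟩ := φ.surjective v
    rcases x with i | j
    · rw [permInvolution_inl]
      exact h i
    · rw [permInvolution_inr]
      simpa using (h (τ.symm j)).symm
  invol v := by
    obtain ⟨x, rfl⟩ := φ.surjective v
    rcases x with i | j
    · rw [permInvolution_inl, permInvolution_inr, Equiv.symm_apply_apply]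
    · rw [permInvolution_inr, permInvolution_inl, Equiv.apply_symm_apply]

lemma exists_isGood_eq (hb : ∀ i, IsBlack (φ (Sum.inl i)))
    {μ : Fin m × Fin m → Fin m × Fin m} (hμ : IsDimer μ) :
    ∃ τ, IsGood φ τ ∧ permInvolution φ τ = μ := by
  have h1 (i : Fin k) : ∃ j, φ (Sum.inr j) = μ (φ (Sum.inl i)) := by
    obtain ⟨x, hx⟩ := φ.surjective (μ (φ (Sum.inl i)))
    rcases x with j | j
    · have := (isBlack_iff_of_adj (hμ.adj (φ (Sum.inl i)))).1 (hx ▸ hb j)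
      exact absurd (hb i) this
    · exact ⟨j, hx⟩
  choose t ht using h1
  have hinj : Function.Injective t := by
    intro i j hij
    have : μ (φ (Sum.inl i)) = μ (φ (Sum.inl j)) := by rw [← ht, ← ht, hij]
    exact Sum.inl_injective (φ.injective (hμ.bijective.1 this))
  refine ⟨Equiv.ofBijective t (Finite.injective_iff_bijective.1 hinj), fun i => ?_, ?_⟩
  · rw [Equiv.ofBijective_apply, ht]
    exact hμ.adj _
  · funext v
    obtain ⟨x, rfl⟩ := φ.surjective v
    rcases x with i | j
    · rw [permInvolution_inl, Equiv.ofBijective_apply, ht]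
    · obtain ⟨i, rfl⟩ := (Finite.injective_iff_bijective.1 hinj).2 j
      rw [permInvolution_inr, Equiv.ofBijective_symm_apply_apply, ht, hμ.invol]

lemma permInvolution_injective : Function.Injective (permInvolution φ) := by
  intro τ σ h
  ext i
  have h1 := congrFun h (φ (Sum.inl i))
  rw [permInvolution_inl, permInvolution_inl] at h1
  rw [Sum.inr_injective (φ.injective h1)]

lemma prod_eq_prod_dimer {M : Type*} [CommMonoid M] (τ : Equiv.Perm (Fin k))
    (F : Fin m × Fin m → M) :
    ∏ v, F v = ∏ i, (F (φ (Sum.inl i)) * F (φ (Sum.inr (τ i)))) := by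
  rw [← φ.prod_comp, Fintype.prod_sum_type, prod_mul_distrib,
    Equiv.prod_comp τ (fun j => F (φ (Sum.inr j)))]

variable (φ) in
/-- The common sign of all the nonzero terms in the determinant of the Kasteleyn matrix. -/
def termSign : ℤ :=
  (∏ i : Fin k, ∏ j ∈ Ioi i, lexSign (φ (Sum.inl i)) (φ (Sum.inl j))) *
  (∏ i : Fin k, ∏ _j ∈ Ioi i, (-1)) *
  (∏ i : Fin k, ∏ j ∈ Ioi i, lexSign (φ (Sum.inr i)) (φ (Sum.inr j))) *
  (∏ i : Fin k, ∏ j : Fin k, lexSign (φ (Sum.inr j)) (φ (Sum.inl i))) * (∏ _i : Fin k, (-1))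

lemma termSign_sq : termSign φ ^ 2 = 1 := by
  have h (x y : Fin m × Fin m) : lexSign x y ^ 2 = 1 := by rw [sq, lexSign_mul_self]
  simp only [termSign, mul_pow, ← prod_pow, h, neg_one_sq, prod_const_one, mul_one]

lemma prod_lexSign_eq (τ : Equiv.Perm (Fin k)) :
    ∏ i : Fin k, ∏ j ∈ Ioi i,
      ((lexSign (φ (Sum.inl i)) (φ (Sum.inl j)) * lexSign (φ (Sum.inl i)) (φ (Sum.inr (τ j)))) *
      (lexSign (φ (Sum.inr (τ i))) (φ (Sum.inl j)) *
        lexSign (φ (Sum.inr (τ i))) (φ (Sum.inr (τ j))))) =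
    termSign φ * (Equiv.Perm.sign τ *
      ∏ i, lexSign (φ (Sum.inl i)) (φ (Sum.inr (τ i)))) := by
  have hne (i j : Fin k) : φ (Sum.inl i) ≠ φ (Sum.inr j) := fun h => by
    simpa using φ.injective h
  have hsign : ∏ i : Fin k, ∏ j ∈ Ioi i, lexSign (φ (Sum.inr (τ i))) (φ (Sum.inr (τ j))) =
      Equiv.Perm.sign τ * ∏ i : Fin k, ∏ j ∈ Ioi i, lexSign (φ (Sum.inr i)) (φ (Sum.inr j)) := by
    have h := τ.prod_Ioi_comp_eq_sign_mul_prod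
      (f := fun i j => if i = j then (0 : ℤ) else lexSign (φ (Sum.inr i)) (φ (Sum.inr j)))
      fun i j => by
        by_cases hij : i = j
        · simp [hij]
        · rw [if_neg hij, if_neg (Ne.symm hij),
            lexSign_swap fun e => hij (Sum.inr_injective (φ.injective e)).symm]
    have e (g : Fin k → Fin k) (hg : Function.Injective g) : ∏ i : Fin k, ∏ j ∈ Ioi i,
        (if g i = g j then (0 : ℤ) else lexSign (φ (Sum.inr (g i))) (φ (Sum.inr (g j)))) =
        ∏ i : Fin k, ∏ j ∈ Ioi i, lexSign (φ (Sum.inr (g i))) (φ (Sum.inr (g j))) :=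
      prod_congr rfl fun i _ => prod_congr rfl fun j hj =>
        if_neg fun hij => (mem_Ioi.1 hj).ne (hg hij)
    have e1 := e id Function.injective_id
    simp only [id] at e1
    rw [← e τ τ.injective, ← e1, h, Int.cast_id]
  have hoff := prod_prod_Ioi_mul_eq_prod_prod_off_diag
    (fun i j : Fin k => lexSign (φ (Sum.inr (τ i))) (φ (Sum.inl j)))
  have hall : ∏ i : Fin k, ∏ j : Fin k, lexSign (φ (Sum.inr j)) (φ (Sum.inl i)) =
      (∏ i, lexSign (φ (Sum.inr (τ i))) (φ (Sum.inl i))) *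
        ∏ i : Fin k, ∏ j ∈ {i}ᶜ, lexSign (φ (Sum.inr (τ j))) (φ (Sum.inl i)) := by
    rw [← prod_mul_distrib]
    refine prod_congr rfl fun i _ => ?_
    rw [← Equiv.prod_comp τ, Fintype.prod_eq_mul_prod_compl i]
  have hdiag : (∏ i, lexSign (φ (Sum.inr (τ i))) (φ (Sum.inl i))) =
      (∏ _i : Fin k, (-1)) * ∏ i, lexSign (φ (Sum.inl i)) (φ (Sum.inr (τ i))) := by
    rw [← prod_mul_distrib]
    refine prod_congr rfl fun i _ => ?_
    rw [lexSign_swap (hne i (τ i)), neg_one_mul]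
  have hsq : (∏ i, lexSign (φ (Sum.inl i)) (φ (Sum.inr (τ i)))) ^ 2 = 1 := by
    rw [← prod_pow]
    exact prod_eq_one fun i _ => by rw [sq, lexSign_mul_self]
  have hsq' : (∏ _i : Fin k, (-1 : ℤ)) ^ 2 = 1 := by
    rw [← prod_pow]
    exact prod_eq_one fun i _ => by norm_num
  have hcalc : ∏ i : Fin k, ∏ j ∈ Ioi i,
      ((lexSign (φ (Sum.inl i)) (φ (Sum.inl j)) * lexSign (φ (Sum.inl i)) (φ (Sum.inr (τ j)))) *
      (lexSign (φ (Sum.inr (τ i))) (φ (Sum.inl j)) *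
        lexSign (φ (Sum.inr (τ i))) (φ (Sum.inr (τ j))))) =
      (∏ i : Fin k, ∏ j ∈ Ioi i, lexSign (φ (Sum.inl i)) (φ (Sum.inl j))) *
      (∏ i : Fin k, ∏ j ∈ Ioi i, (-1)) *
      (∏ i : Fin k, ∏ j ∈ Ioi i, (lexSign (φ (Sum.inr (τ j))) (φ (Sum.inl i)) *
        lexSign (φ (Sum.inr (τ i))) (φ (Sum.inl j)))) *
      ∏ i : Fin k, ∏ j ∈ Ioi i, lexSign (φ (Sum.inr (τ i))) (φ (Sum.inr (τ j))) := by
    simp only [← prod_mul_distrib]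
    refine prod_congr rfl fun i _ => prod_congr rfl fun j _ => ?_
    rw [lexSign_swap (hne i (τ j))]
    ring
  rw [hcalc, hoff, hsign, termSign, hall, hdiag]
  generalize (∏ i, lexSign (φ (Sum.inl i)) (φ (Sum.inr (τ i)))) = Y at *
  generalize (∏ _i : Fin k, (-1 : ℤ)) = Z at *
  generalize (∏ i : Fin k, ∏ j ∈ Ioi i, (-1 : ℤ)) = N at *
  generalize (∏ i : Fin k, ∏ j ∈ {i}ᶜ, lexSign (φ (Sum.inr (τ j))) (φ (Sum.inl i))) = X at *
  generalize (∏ i : Fin k, ∏ j ∈ Ioi i, lexSign (φ (Sum.inl i)) (φ (Sum.inl j))) = A at *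
  generalize (∏ i : Fin k, ∏ j ∈ Ioi i, lexSign (φ (Sum.inr i)) (φ (Sum.inr j))) = B at *
  have : A * N * B * (Z * Y * X) * Z * ((Equiv.Perm.sign τ : ℤ) * Y) =
    A * N * B * X * (Equiv.Perm.sign τ : ℤ) * (Z ^ 2 * Y ^ 2) := by ring
  rw [this, hsq, hsq']
  ring

lemma IsGood.prod_crossing {τ : Equiv.Perm (Fin k)} (h : IsGood φ τ) :
    ∏ i : Fin k, ∏ j ∈ Ioi i,
      ((lexSign (φ (Sum.inl i)) (φ (Sum.inl j)) * lexSign (φ (Sum.inl i)) (φ (Sum.inr (τ j)))) *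
      (lexSign (φ (Sum.inr (τ i))) (φ (Sum.inl j)) *
        lexSign (φ (Sum.inr (τ i))) (φ (Sum.inr (τ j))))) =
    ∏ i, (if ((φ (Sum.inl i)).1 : ℕ) = (φ (Sum.inr (τ i))).1 then 1
      else (-1) ^ ((φ (Sum.inl i)).2 : ℕ)) := by
  set μ := permInvolution φ τ with hμdef
  have hμ : IsDimer μ := h.isDimer
  have hbw (i : Fin k) : φ (Sum.inr (τ i)) = μ (φ (Sum.inl i)) := (permInvolution_inl φ τ i).symm
  have h1 : ∏ i : Fin k, ∏ j : Fin k, dimerCrossSign μ (φ (Sum.inl j)) (φ (Sum.inl i)) =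
      ∏ i : Fin k, ∏ j ∈ {i}ᶜ, dimerCrossSign μ (φ (Sum.inl j)) (φ (Sum.inl i)) := by
    refine prod_congr rfl fun i _ => ?_
    rw [Fintype.prod_eq_mul_prod_compl i, hμ.dimerCrossSign_self, one_mul]
  have h2 := prod_prod_Ioi_mul_eq_prod_prod_off_diag
    (fun i j : Fin k => dimerCrossSign μ (φ (Sum.inl i)) (φ (Sum.inl j)))
  have h3 : ∏ i : Fin k, ∏ j : Fin k, dimerCrossSign μ (φ (Sum.inl j)) (φ (Sum.inl i)) =
      ∏ u, ∏ v, crossSign μ u v := by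
    rw [prod_comm, prod_eq_prod_dimer τ]
    refine prod_congr rfl fun i _ => ?_
    rw [prod_eq_prod_dimer τ, prod_eq_prod_dimer τ, ← prod_mul_distrib]
    refine prod_congr rfl fun j _ => ?_
    rw [hbw, hbw, dimerCrossSign]
  have h4 : ∏ i : Fin k, ∏ j ∈ Ioi i,
      ((lexSign (φ (Sum.inl i)) (φ (Sum.inl j)) * lexSign (φ (Sum.inl i)) (φ (Sum.inr (τ j)))) *
      (lexSign (φ (Sum.inr (τ i))) (φ (Sum.inl j)) *
        lexSign (φ (Sum.inr (τ i))) (φ (Sum.inr (τ j))))) =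
      ∏ i : Fin k, ∏ j ∈ Ioi i, (dimerCrossSign μ (φ (Sum.inl j)) (φ (Sum.inl i)) *
        dimerCrossSign μ (φ (Sum.inl i)) (φ (Sum.inl j))) := by
    refine prod_congr rfl fun i _ => prod_congr rfl fun j hj => ?_
    have hij : φ (Sum.inl i) ≠ φ (Sum.inl j) := fun e =>
      (mem_Ioi.1 hj).ne (Sum.inl_injective (φ.injective e))
    have hij' : φ (Sum.inl i) ≠ μ (φ (Sum.inl j)) := fun e => by
      rw [← hbw] at e
      simpa using φ.injective e
    rw [hbw, hbw, hμ.crossing hij hij', mul_comm]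
  rw [h4, h2, ← h1, h3, hμ.prod_prod_crossSign, prod_eq_prod_dimer τ]
  refine prod_congr rfl fun i _ => ?_
  rw [hbw]
  rcases hμ.isTop_or (φ (Sum.inl i)) with ht | ht | ht
  · have h5 := ht.1
    unfold IsTop at h5
    rw [if_pos ht.1, if_neg ht.2.1, if_neg (by omega), mul_one]
  · rw [if_neg ht.2.1, if_pos ht.1, if_neg (by omega), one_mul, ht.2.2.1]
  · rw [if_neg ht.1, if_neg ht.2.1, if_pos ht.2.2.1.symm, one_mul]

variable (φ) in
/-- The block of the Kasteleyn matrix from black to white vertices. -/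
def kasteleynBlock : Matrix (Fin k) (Fin k) ℤ :=
  Matrix.of fun j i => kasteleyn ℤ m (φ (Sum.inl i)) (φ (Sum.inr j))

lemma IsGood.term_eq {τ : Equiv.Perm (Fin k)} (h : IsGood φ τ) :
    (Equiv.Perm.sign τ : ℤ) * ∏ i, kasteleynBlock φ (τ i) i = termSign φ := by
  have h1 : ∏ i, kasteleynBlock φ (τ i) i =
      (∏ i, lexSign (φ (Sum.inl i)) (φ (Sum.inr (τ i)))) *
        (termSign φ * (Equiv.Perm.sign τ * ∏ i, lexSign (φ (Sum.inl i)) (φ (Sum.inr (τ i))))) := by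
    rw [← prod_lexSign_eq, h.prod_crossing, ← prod_mul_distrib]
    exact prod_congr rfl fun i _ => kasteleyn_of_adj (h i)
  have hsq : (∏ i, lexSign (φ (Sum.inl i)) (φ (Sum.inr (τ i)))) ^ 2 = 1 := by
    rw [← prod_pow]
    exact prod_eq_one fun i _ => by rw [sq, lexSign_mul_self]
  have hs : ((Equiv.Perm.sign τ : ℤ)) ^ 2 = 1 := by
    rw [← Units.val_pow_eq_pow_val, Int.units_sq, Units.val_one]
  rw [h1]
  linear_combination termSign φ * (∏ i, lexSign (φ (Sum.inl i)) (φ (Sum.inr (τ i)))) ^ 2 * hs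
    + termSign φ * hsq

lemma det_kasteleynBlock :
    (kasteleynBlock φ).det = termSign φ * Nat.card {τ : Equiv.Perm (Fin k) // IsGood φ τ} := by
  classical
  rw [Matrix.det_apply', Nat.card_eq_fintype_card, Fintype.card_subtype, mul_comm, ← nsmul_eq_mul,
    ← sum_const, sum_filter]
  refine sum_congr rfl fun τ _ => ?_
  split_ifs with h
  · exact h.term_eq
  · obtain ⟨i, hi⟩ := not_forall.1 h
    rw [prod_eq_zero (mem_univ i), mul_zero]
    exact kasteleyn_eq_zero hi

lemma det_kasteleyn_mul_self (hb : ∀ i, IsBlack (φ (Sum.inl i)))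
    (hw : ∀ i, ¬ IsBlack (φ (Sum.inr i))) :
    (kasteleyn ℤ m * kasteleyn ℤ m).det = (kasteleynBlock φ).det ^ 4 := by
  set K := kasteleynBlock φ with hK
  have h1 : (kasteleyn ℤ m).submatrix φ φ = Matrix.fromBlocks 0 K.transpose (-K) 0 := by
    ext x y
    rcases x with i | i <;> rcases y with j | j
    · refine kasteleyn_eq_zero fun h => ?_
      exact (isBlack_iff_of_adj h).1 (hb j) (hb i)
    · rfl
    · exact kasteleyn_swap _ _
    · refine kasteleyn_eq_zero fun h => ?_
      exact hw j ((isBlack_iff_of_adj h).2 (hw i))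
  have h2 : (kasteleyn ℤ m * kasteleyn ℤ m).submatrix φ φ =
      (kasteleyn ℤ m).submatrix φ φ * (kasteleyn ℤ m).submatrix φ φ :=
    (Matrix.submatrix_mul_equiv _ _ _ _ _).symm
  rw [← Matrix.det_submatrix_equiv_self φ, h2, h1, Matrix.fromBlocks_multiply]
  simp only [Matrix.zero_mul, Matrix.mul_zero, add_zero, zero_add, Matrix.mul_neg, Matrix.neg_mul,
    neg_zero]
  rw [Matrix.det_fromBlocks_zero₂₁, Matrix.det_neg, Matrix.det_neg, Matrix.det_mul, Matrix.det_mul,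
    Matrix.det_transpose]
  have h3 : ((-1 : ℤ) ^ Fintype.card (Fin k)) ^ 2 = 1 := by
    rw [← pow_mul, mul_comm, pow_mul, neg_one_sq, one_pow]
  linear_combination K.det ^ 4 * h3

end

/-- Perfect matchings of the square lattice graph are the same as fixed point free involutions
moving every vertex to an adjacent one. -/
noncomputable def perfectMatchingEquiv (m : ℕ) :
    {M : (squareLattice m).Subgraph // M.IsPerfectMatching} ≃
      {μ : Fin m × Fin m → Fin m × Fin m // IsDimer μ} where
  toFun M := ⟨fun v => (SimpleGraph.Subgraph.isPerfectMatching_iff.1 M.2 v).choose, {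
    adj := fun v => M.1.adj_sub (SimpleGraph.Subgraph.isPerfectMatching_iff.1 M.2 v).choose_spec.1
    invol := fun v => by
      have h := SimpleGraph.Subgraph.isPerfectMatching_iff.1 M.2
      exact ((h (h v).choose).choose_spec.2 v (h v).choose_spec.1.symm).symm }⟩
  invFun μ := ⟨{
    verts := Set.univ
    Adj := fun u v => μ.1 u = v
    adj_sub := fun {u v} h => h ▸ μ.2.adj u
    edge_vert := fun _ => Set.mem_univ _
    symm := ⟨fun u v h => by rw [← h, μ.2.invol]⟩ }, by
      rw [SimpleGraph.Subgraph.isPerfectMatching_iff]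
      exact fun v => ⟨μ.1 v, rfl, fun w h => Eq.symm h⟩⟩
  left_inv M := by
    have h := SimpleGraph.Subgraph.isPerfectMatching_iff.1 M.2
    apply Subtype.ext
    refine SimpleGraph.Subgraph.ext ?_ ?_
    · exact (Set.eq_univ_of_forall fun v => M.2.2 v).symm
    · funext u v
      refine propext ⟨?_, fun huv => ((h u).choose_spec.2 v huv).symm⟩
      rintro rfl
      exact (h u).choose_spec.1
  right_inv μ := by
    apply Subtype.ext
    funext v
    have h : ∃! w, μ.1 v = w := ⟨μ.1 v, rfl, fun w h => h.symm⟩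
    exact h.choose_spec.1.symm

lemma dimerCount_eq (n : ℕ) : (dimerCount n : ℝ) = 2 ^ n * cosRootProd n ^ 2 := by
  obtain ⟨k, φ, hb, hw⟩ := exists_coloring_equiv n
  have h1 : dimerCount n = Nat.card {τ : Equiv.Perm (Fin k) // IsGood φ τ} := by
    rw [dimerCount, Nat.card_congr (perfectMatchingEquiv (2 * n))]
    refine (Nat.card_congr (Equiv.ofBijective
      (fun τ : {τ : Equiv.Perm (Fin k) // IsGood φ τ} =>
        (⟨permInvolution φ τ.1, τ.2.isDimer⟩ : {μ // IsDimer μ})) ⟨?_, ?_⟩)).symm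
    · intro τ σ h
      exact Subtype.ext (permInvolution_injective (congrArg Subtype.val h))
    · rintro ⟨μ, hμ⟩
      obtain ⟨τ, hτ, rfl⟩ := exists_isGood_eq hb hμ
      exact ⟨⟨τ, hτ⟩, rfl⟩
  have h2 := det_kasteleyn_sq_eq n
  rw [kasteleyn_map, ← Matrix.map_mul, ← RingHom.mapMatrix_apply, ← RingHom.map_det,
    det_kasteleyn_mul_self hb hw, det_kasteleynBlock, ← h1] at h2
  have h3 : (dimerCount n : ℝ) ^ 4 = (2 ^ n * cosRootProd n ^ 2) ^ 4 := by
    rw [mul_pow (termSign φ), show termSign φ ^ 4 = (termSign φ ^ 2) ^ 2 by ring, termSign_sq,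
      one_pow, one_mul] at h2
    have h4 : ((((dimerCount n : ℝ) ^ 4 : ℝ)) : ℂ) = (((2 ^ n * cosRootProd n ^ 2) ^ 4 : ℝ) : ℂ) := by
      rw [← h2]
      push_cast
      simp
    exact_mod_cast h4
  exact (pow_left_inj₀ (by positivity) (by positivity) (by norm_num)).1 h3

end Domino

theorem theoremB :
    ∃ B : ℕ → ℤ,
      (∀ n : ℕ, 1 ≤ n → 0 < B n ∧ (dimerCount n : ℤ) = 2 ^ n * B n ^ 2) ∧
      (∀ l : ℕ,
        B (2 * l + 1) ≡
          -16 * ((l : ℤ) + 1) * (Nat.choose (l + 2) 3 : ℤ) - 16 * (Nat.choose (l + 2) 4 : ℤ)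
            - 4 * (Nat.choose (l + 1) 2 : ℤ) + 1 [ZMOD 64]) ∧
      (∀ l : ℕ, 1 ≤ l →
        (-1) ^ l * B (2 * l) ≡
          -16 * (l : ℤ) * (Nat.choose (l + 1) 3 : ℤ) - 16 * (Nat.choose (l + 2) 4 : ℤ)
            - 4 * (Nat.choose (l + 1) 2 : ℤ) + 1 [ZMOD 64]) := by
  choose B hB using Domino.exists_int_eq_cosRootProd
  refine ⟨B, fun n _ => ⟨?_, ?_⟩, fun l => Domino.cosRootProd_odd_modEq (hB _),
    fun l hl => Domino.cosRootProd_even_modEq hl (hB _)⟩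
  · have := Domino.cosRootProd_pos n
    rw [hB] at this
    exact_mod_cast this
  · have := Domino.dimerCount_eq n
    rw [hB] at this
    exact_mod_cast this
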